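/- **Definitions.** All simplicial complexes are finite and contain the empty face. For a complex $K$, $P_1(K)$ is the poset of all faces of $K$ (including $\emptyset$) with a maximal element $\widehat 1$ adjoined. A finite graded poset with $\widehat 0$ and $\widehat 1$ is *Eulerian* if every interval $[s,t]$ with $s<t$ has equally many elements of even and of odd rank. For such a poset $P$ of rank $n+1$ and $T\subseteq[n]$ let $\alpha_P(T)$ be the number of chains with rank set $T$, $\beta_P(T)=\sum_{R\subseteq T}(-1)^{|T\setminus R|}\alpha_P(R)$, and $\Psi_P(a,b)=\sum_{T\subseteq[n]}\beta_P(T)\,u_1\cdots u_n$, where $a,b$ do not commute and $u_j=b$ if $j\in T$, $u_j=a$ otherwise. The *cd-index* $\Phi_P(c,d)$ is the noncommutative integer polynomial with $\Phi_P(a+b,ab+ba)=\Psi_P(a,b)$. A poset $P$ is *near-Eulerian* if it is an Eulerian poset with one coatom removed. Its boundary $\partial P$ consists of $\widehat 1$ and all elements lying below some $z$ for which $[z,\widehat 1]$ has exactly three elements. Its semisuspension $\widetilde\Sigma P$ is obtained by adding a coatom that lies above exactly the elements of $\partial P\setminus\{\widehat 1\}$. Its *local cd-index* is $\check\Phi_P=\Phi_{\widetilde\Sigma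 P}-\Phi_{\partial P}\cdot c$. For a complex $K$ with $P_1(K)$ near-Eulerian write $\check\Phi_K=\check\Phi_{P_1(K)}$ and $\Phi_{\partial K}=\Phi_{\partial P_1(K)}$. An $n$-dimensional complex $S$, $n\ge 0$, is *Gorenstein* if for every face $x$ of $S$ (including $x=\emptyset$, of dimension $-1$, whose link is $S$) the reduced homology $\widetilde H_j(\mathrm{Link}_S(x);\mathbb R)$ is $\mathbb R$ for $j=n-\dim x-1$ and $0$ for all other $j$. A *shelling* of a pure $n$-dimensional complex is a linear order $F_1,\dots,F_k$ of its facets, arbitrary if $n=0$, such that, if $n\ge1$, $\partial F_1$ has a shelling and for each $1<j\le k$ there are a shelling $G_1,\dots,G_s$ of $\partial F_j$ and $1\le r\le s$ with $F_j\cap(F_1\cup\dots\cup F_{j-1})=G_1\cup\dots\cup G_r$. **Lemma (the local cd-index grows along a shelling).** Let $S$ be a Gorenstein simplicial complex with a shelling $F_1,\dots,F_k$, let $1\le i\le k-2$, put $\sigma_j=P_1(F_1\cup\dots\cup F_j)$, and let $\Gamma=F_{i+1}\cap(F_1\cup\dots\cup F_i)$ as a subcomplex. Then $\sigma_i$, $\sigma_{i+1}$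 and $P_1(\Gamma)$ are near-Eulerian, and their semisuspensions and boundaries are Eulerian with well-defined cd-indices. Moreover $$\check\Phi_{\sigma_i}\le\check\Phi_{\sigma_{i+1}}\quad\text{(coefficientwise)},$$ and explicitly $$\check\Phi_{\sigma_{i+1}}-\check\Phi_{\sigma_i}=\check\Phi_\Gamma\cdot c+\Phi_{\partial\Gamma}\cdot d .$$ -/

import Mathlib

noncomputable section

namespace CDIndex

universe u

/-! ### Noncommutative polynomials in `a, b` and in `c, d` -/

/-- The two letters of `ab`-words. -/
inductive ABLetter : Type
  | a
  | b

/-- The two letters of `cd`-words. -/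
inductive CDLetter : Type
  | c
  | d

/-- Noncommutative integer polynomials in `a` and `b`. -/
abbrev ABPoly : Type := FreeAlgebra ℤ ABLetter

/-- Noncommutative integer polynomials in `c` and `d`. -/
abbrev CDPoly : Type := FreeAlgebra ℤ CDLetter

/-- The variable `a`. -/
def varA : ABPoly := FreeAlgebra.ι ℤ ABLetter.a

/-- The variable `b`. -/
def varB : ABPoly := FreeAlgebra.ι ℤ ABLetter.b

/-- The variable `c`. -/
def varC : CDPoly := FreeAlgebra.ι ℤ CDLetter.c

/-- The variable `d`. -/
def varD : CDPoly := FreeAlgebra.ι ℤ CDLetter.d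

/-- The substitution `c ↦ a + b`, `d ↦ ab + ba`. -/
def cdToAB : CDPoly →ₐ[ℤ] ABPoly :=
  FreeAlgebra.lift ℤ fun l =>
    match l with
    | CDLetter.c => varA + varB
    | CDLetter.d => varA * varB + varB * varA

/-- The coefficient of the word `w` in a `cd`-polynomial. -/
def cdCoeff (p : CDPoly) (w : FreeMonoid CDLetter) : ℤ :=
  (FreeAlgebra.equivMonoidAlgebraFreeMonoid p).coeff w

/-- Coefficientwise inequality of `cd`-polynomials. -/
def CDLe (p q : CDPoly) : Prop := ∀ w, cdCoeff p w ≤ cdCoeff q w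

/-! ### Posets, flag vectors, `ab`-index and `cd`-index -/

section Poset

variable (P : Type u) [PartialOrder P]

variable {P} in
/-- The rank of an element: the largest length of a chain ending at it. On a finite graded poset
this is the rank function. -/
def rk (x : P) : ℕ := (Order.height x).toNat

/-- The rank of a finite poset. -/
def posetRank : ℕ := ⨆ x : P, rk x

/-- All maximal chains have the same length. -/
def IsGraded : Prop := ∃ n : ℕ, ∀ C : Flag P, (C : Set P).ncard = n + 1

/-- Eulerian posets: finite, graded, with `0` and `1`, such that every interval `[s, t]` with
`s < t` has as many elements of even rank as of odd rank. -/
structure IsEulerian : Prop where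
  finite : Finite P
  exists_bot : ∃ z : P, IsBot z
  exists_top : ∃ t : P, IsTop t
  graded : IsGraded P
  balanced : ∀ s t : P, s < t →
    {x : P | x ∈ Set.Icc s t ∧ Even (rk x)}.ncard = {x : P | x ∈ Set.Icc s t ∧ Odd (rk x)}.ncard

/-- The flag `f`-vector: the number of chains whose set of ranks is exactly `T`. (In a graded poset
with `0` and `1` these chains are the maximal chains of the rank-selected subposet `P_T`.) -/
def flagF (T : Finset ℕ) : ℤ :=
  ({C : Set P | IsChain (· ≤ ·) C ∧ rk '' C = (T : Set ℕ)}.ncard : ℤ)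

/-- The flag `h`-vector. -/
def flagH (T : Finset ℕ) : ℤ :=
  ∑ R ∈ T.powerset, (-1) ^ (T \ R).card * flagF P R

/-- The word `u_1 u_2 ⋯ u_n` with `u_i = b` if `i ∈ T` and `u_i = a` otherwise. -/
def abWord (n : ℕ) (T : Finset ℕ) : ABPoly :=
  ((List.range n).map fun i => if i + 1 ∈ T then varB else varA).prod

/-- The `ab`-index of a graded poset of rank `n + 1` with `0` and `1`: the sum over all
`T ⊆ {1, …, n}` of the flag `h`-number of `T` times the word of `T`. -/
def abIndex : ABPoly :=
  ∑ T ∈ (Finset.Icc 1 (posetRank P - 1)).powerset, flagH P T • abWord (posetRank P - 1) T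

/-- The `cd`-polynomial `φ` satisfies `φ(a + b, ab + ba) = Ψ_P(a, b)`. -/
def IsCDIndex (φ : CDPoly) : Prop := cdToAB φ = abIndex P

open Classical in
/-- The `cd`-index (with the value `0` if there is none). -/
def cdIndex : CDPoly := if h : ∃ φ, IsCDIndex P φ then h.choose else 0

/-- `P` is Eulerian and its `cd`-index is well defined. -/
def HasCDIndex : Prop := IsEulerian P ∧ ∃! φ, IsCDIndex P φ

/-- Near-Eulerian posets: an Eulerian poset with one coatom removed. -/
def IsNearEulerian : Prop :=
  ∃ (Q : Type u) (_ : PartialOrder Q) (x t : Q),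
    IsEulerian Q ∧ IsTop t ∧ x ⋖ t ∧ Nonempty (P ≃o {y : Q // y ≠ x})

variable {P} in
/-- `y` lies below some `z` such that the interval `[z, 1]` has exactly three elements. -/
def OnBoundary (y : P) : Prop := ∃ z : P, y ≤ z ∧ (Set.Ici z).ncard = 3

/-- The boundary `∂P` of a near-Eulerian poset: all elements that lie below some `z` for which
`[z, 1]` has exactly three elements, together with `1`. -/
abbrev BoundaryPoset : Type u := {y : P // OnBoundary y ∨ IsTop y}

/-- The elements of the semisuspension: those of `P`, and a new coatom. -/
inductive Semisuspension : Type u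
  | old : P → Semisuspension
  | new : Semisuspension

namespace Semisuspension

variable {P}

/-- The order of the semisuspension: the new element lies above the elements `z` for which `[z, 1]`
has exactly three elements (and everything below those), and below `1` only. -/
protected def le : Semisuspension P → Semisuspension P → Prop
  | old x, old y => x ≤ y
  | old x, new => OnBoundary x
  | new, old y => IsTop y
  | new, new => True

theorem not_isTop_of_onBoundary {x : P} (h : OnBoundary x) (hx : IsTop x) : False := by
  obtain ⟨z, hz, h3⟩ := h
  have hIci : Set.Ici z = {z} := by
    ext w
    simp only [Set.mem_Ici, Set.mem_singleton_iff]
    exact ⟨fun hw => le_antisymm ((hx w).trans hz) hw, fun hw => hw.ge⟩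
  rw [hIci, Set.ncard_singleton] at h3
  omega

instance : PartialOrder (Semisuspension P) where
  le := Semisuspension.le
  le_refl x := by
    cases x with
    | old x => exact le_refl x
    | new => exact trivial
  le_trans x y z hxy hyz := by
    cases x with
    | old x =>
      cases y with
      | old y =>
        cases z with
        | old z => exact le_trans (α := P) hxy hyz
        | new =>
          obtain ⟨w, hw, h3⟩ := hyz
          exact ⟨w, le_trans (α := P) hxy hw, h3⟩
      | new =>
        cases z with
        | old z => exact hyz x
        | new => exact hxy
    | new =>
      cases y with
      | old y =>
        cases z with
        | old z => exact fun w => le_trans (α := P) (hxy w) hyz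
        | new => exact trivial
      | new => exact hyz
  le_antisymm x y hxy hyx := by
    cases x with
    | old x =>
      cases y with
      | old y => exact congrArg old (le_antisymm (α := P) hxy hyx)
      | new => exact (not_isTop_of_onBoundary hxy hyx).elim
    | new =>
      cases y with
      | old y => exact (not_isTop_of_onBoundary hyx hxy).elim
      | new => rfl

end Semisuspension

/-- The local `cd`-index of a near-Eulerian poset: the `cd`-index of its semisuspension minus the
`cd`-index of its boundary times `c`. -/
def localCDIndex : CDPoly :=
  cdIndex (Semisuspension P) - cdIndex (BoundaryPoset P) * varC

/-- `P` is near-Eulerian and the two `cd`-indices that make up its local `cd`-index are well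
defined. -/
def HasLocalCDIndex : Prop :=
  IsNearEulerian P ∧ HasCDIndex (Semisuspension P) ∧ HasCDIndex (BoundaryPoset P)

end Poset

/-! ### Simplicial complexes

Mathlib's `PreAbstractSimplicialComplex` lists the nonempty faces only; the empty face is added
where it plays a role. -/

section Complex

variable {V : Type u}

/-- All faces of a complex, including the empty one. -/
def allFaces (K : PreAbstractSimplicialComplex V) : Set (Finset V) := insert ∅ K.faces

/-- The poset `P_1(K)`: the faces of `K`, including the empty face, with a maximal element
adjoined. -/
abbrev P1 (K : PreAbstractSimplicialComplex V) : Type u := WithTop {s : Finset V // s ∈ allFaces K}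

/-- The complex generated by a list of simplices, that is, their union `F_1 ∪ ⋯ ∪ F_k`. -/
def generated (L : List (Finset V)) : PreAbstractSimplicialComplex V where
  faces := {s | s.Nonempty ∧ ∃ F ∈ L, s ⊆ F}
  isRelLowerSet_faces := by
    rintro s ⟨hs, F, hF, hsF⟩
    exact ⟨hs, fun t hts ht => ⟨ht, F, hF, Finset.Subset.trans hts hsF⟩⟩

/-- The simplex `F` as a complex. -/
abbrev simplex (F : Finset V) : PreAbstractSimplicialComplex V := generated [F]

/-- The boundary complex `∂F` of the simplex `F`. -/
def simplexBoundary (F : Finset V) : PreAbstractSimplicialComplex V where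
  faces := {s | s.Nonempty ∧ s ⊂ F}
  isRelLowerSet_faces := by
    rintro s ⟨hs, hsF⟩
    exact ⟨hs, fun t hts ht => ⟨ht, lt_of_le_of_lt hts hsF⟩⟩

/-- `K` is a finite pure complex of dimension `n`, and `L` is a linear order of its facets. -/
structure IsFacetOrder (n : ℕ) (K : PreAbstractSimplicialComplex V) (L : List (Finset V)) :
    Prop where
  finite : K.faces.Finite
  nonempty : K.faces.Nonempty
  pure : ∀ F, Maximal (· ∈ K.faces) F → F.card = n + 1
  nodup : L.Nodup
  mem_iff : ∀ F, F ∈ L ↔ Maximal (· ∈ K.faces) F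

/-- `L` is a shelling of the pure `n`-dimensional complex `K`. In dimension `0` every linear order
of the facets is a shelling. In positive dimension `∂F_1` has to have a shelling, and for each later
facet `F_j` the complex `F_j ∩ (F_1 ∪ ⋯ ∪ F_{j-1})` has to be `G_1 ∪ ⋯ ∪ G_r` for a shelling
`G_1, …, G_s` of `∂F_j` and some `1 ≤ r ≤ s`. (Lists are indexed from `0`.) -/
def IsShelling : ℕ → PreAbstractSimplicialComplex V → List (Finset V) → Prop
  | 0, K, L => IsFacetOrder 0 K L
  | n + 1, K, L => IsFacetOrder (n + 1) K L ∧
      (∀ h : 0 < L.length, ∃ M, IsShelling n (simplexBoundary L[0]) M) ∧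
      ∀ (j : ℕ) (hj : j < L.length), 0 < j →
        ∃ (M : List (Finset V)) (r : ℕ), IsShelling n (simplexBoundary L[j]) M ∧
          1 ≤ r ∧ r ≤ M.length ∧
          simplex L[j] ⊓ generated (L.take j) = generated (M.take r)

variable [Fintype V] [LinearOrder V]

/-- The link of a face `x`: the faces disjoint from `x` whose union with `x` is a face. -/
def link (K : PreAbstractSimplicialComplex V) (x : Finset V) : PreAbstractSimplicialComplex V where
  faces := {s | s.Nonempty ∧ Disjoint s x ∧ s ∪ x ∈ K.faces}
  isRelLowerSet_faces := by
    rintro s ⟨hs, hd, hK⟩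
    refine ⟨hs, fun t hts ht => ⟨ht, Finset.disjoint_of_subset_left hts hd, ?_⟩⟩
    exact (K.isRelLowerSet_faces hK).2 (Finset.union_subset_union hts (Finset.Subset.refl x))
      (ht.mono Finset.subset_union_left)

/-- The simplicial boundary map, on formal real combinations of finite subsets of `V`. A combination
is the function of its coefficients. Each simplex is oriented by the linear order of its vertices, so
that `s` is sent to the sum over `v ∈ s` of `(-1) ^ #{u ∈ s | u < v}` times `s \ {v}`; here the
coefficient of `t = s \ {v}` is collected from all `s = t ∪ {v}`. The vertices are sent to the empty
simplex, as in reduced homology. -/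
def bdryMap : (Finset V → ℝ) →ₗ[ℝ] (Finset V → ℝ) where
  toFun f t := ∑ v ∈ tᶜ, (-1 : ℝ) ^ (t.filter (· < v)).card * f (insert v t)
  map_add' f g := by
    funext t
    simp [mul_add, Finset.sum_add_distrib]
  map_smul' r f := by
    funext t
    simp only [Pi.smul_apply, smul_eq_mul, RingHom.id_apply, Finset.mul_sum]
    exact Finset.sum_congr rfl fun v _ => by ring

/-- The chains of `K` on faces with `j` vertices, that is, of dimension `j - 1`. -/
def chains (K : PreAbstractSimplicialComplex V) (j : ℕ) : Submodule ℝ (Finset V → ℝ) where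
  carrier := {f | ∀ s, f s ≠ 0 → s ∈ allFaces K ∧ s.card = j}
  add_mem' {f g} hf hg s hs := by
    by_cases h : f s = 0
    · exact hg s fun h' => hs (by simp [h, h'])
    · exact hf s h
  zero_mem' s hs := (hs rfl).elim
  smul_mem' r f hf s hs := hf s fun h => hs (by simp [h])

/-- The cycles of dimension `j - 1`. -/
def cycles (K : PreAbstractSimplicialComplex V) (j : ℕ) : Submodule ℝ (Finset V → ℝ) :=
  chains K j ⊓ LinearMap.ker bdryMap

/-- The boundaries of dimension `j - 1`. -/
def boundaries (K : PreAbstractSimplicialComplex V) (j : ℕ) : Submodule ℝ (Finset V → ℝ) :=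
  (chains K (j + 1)).map bdryMap

/-- The reduced simplicial homology of `K` with real coefficients, in degree `j - 1`. -/
abbrev RedHomology (K : PreAbstractSimplicialComplex V) (j : ℕ) : Type u :=
  cycles K j ⧸ (boundaries K j).submoduleOf (cycles K j)

/-- `K` is an `n`-dimensional Gorenstein complex (a real homology sphere): for every face `x`, the
empty face (whose link is `K`) included, the reduced homology of the link of `x` is `ℝ` in degree
`n - dim x - 1` and `0` in all other degrees. As `dim x = #x - 1`, and as `RedHomology` is indexed by
the degree plus one, this is the index `j` with `j + #x = n + 1`. -/
structure IsGorenstein (n : ℕ) (K : PreAbstractSimplicialComplex V) : Prop where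
  dim_le : ∀ s ∈ K.faces, s.card ≤ n + 1
  exists_dim : ∃ s ∈ K.faces, s.card = n + 1
  homology : ∀ x ∈ allFaces K, ∀ j : ℕ,
    (j + x.card = n + 1 → Nonempty (RedHomology (link K x) j ≃ₗ[ℝ] ℝ)) ∧
    (j + x.card ≠ n + 1 → Subsingleton (RedHomology (link K x) j))

end Complex

end CDIndex

end

open CDIndex

noncomputable section

namespace CDIndex

open Finset

universe u

/-! Write `e = a - b`. Substituting `a = e + b` turns the `ab`-index into a sum over chains of words
with `b` at the occupied ranks and `e` elsewhere. Grouping chains by their last element `x` below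
the top gives a recursion (`abIndex_eq`): in rank `m + 1`, an `x` of rank `k > 0` contributes
`Ψ[0,x] b e^(m-k)`, and the bottom contributes `e^m`. Lower intervals in face posets are Boolean, so
a face contributes according to its size only, and the indices become additive over sets of faces.

In a shelling the facet `F` added at a given step has a restriction face `R ⊆ F`: its new faces form
the interval `[R, F]`. Put `p = #R` and `q = #(F \ R)`. Then `Γ` is the union of the facets `F \
{v}`, `v ∈ R`, of `∂F`; its interior faces are `[F \ R, F)`, with sum `I(p,q)`; its boundary is the
join `∂R * ∂(F \ R)`, with index `J(p,q)`; and its local index is `L(p,q) = I(p,q) - J(p,q) b`.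
Adding `F` to the earlier facets adds `[R, F]` to the faces, while the boundary loses `[F \ R, F)`
and gains `[R, F)`. Together with the decomposition `boolPsi_add` of `∂F` this makes the local index
grow by exactly `L(p,q) c + J(p,q) d` (`ballLoc_succ`).

Homology enters only through Euler characteristics of links. Combined with the shelling, they force
the intervals `[F_l \ R_l, F_l]` to partition the faces as well, as if the reversed order were a
shelling (`card_opposite`, `isLast_iff`). This gives the Euler relations of a ball for each proper
initial union and those of a sphere for its boundary (`IsSphereShelling.isBall`), hence the Eulerian
posets.

Nonnegativity reduces to that of `L(p,q)` and `J(p,q)`, proved by a simultaneous induction from the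
same growth formula for the boundary of a simplex. The cd-indices exist because they are built step
by step along the shelling, and they are unique because the substitution `c ↦ a + b`, `d ↦ ab + ba`
is injective. -/

/-- The difference `a - b`. -/
def varE : ABPoly := varA - varB

/-! ### Sums over the proper subsets of a finite set. -/

/-- The sum of `h #A` over the proper subsets `A` of a set with `p` elements. -/
def properSum (p : ℕ) (h : ℕ → ABPoly) : ABPoly := ∑ i ∈ range p, p.choose i • h i

theorem properSum_congr {p : ℕ} {h h' : ℕ → ABPoly} (H : ∀ i < p, h i = h' i) :
    properSum p h = properSum p h' :=
  Finset.sum_congr rfl fun i hi => by rw [H i (mem_range.1 hi)]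

theorem properSum_add (p : ℕ) (h h' : ℕ → ABPoly) :
    properSum p (fun i => h i + h' i) = properSum p h + properSum p h' := by
  simp [properSum, Finset.sum_add_distrib]

theorem properSum_mul (p : ℕ) (h : ℕ → ABPoly) (x : ABPoly) :
    properSum p (fun i => h i * x) = properSum p h * x := by
  simp only [properSum, Finset.sum_mul, smul_mul_assoc]

theorem properSum_one (h : ℕ → ABPoly) : properSum 1 h = h 0 := by simp [properSum]

theorem properSum_zero (h : ℕ → ABPoly) : properSum 0 h = 0 := by simp [properSum]

theorem properSum_comm (p q : ℕ) (h : ℕ → ℕ → ABPoly) :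
    properSum p (fun i => properSum q fun j => h i j) =
      properSum q fun j => properSum p fun i => h i j := by
  simp only [properSum, Finset.smul_sum]
  rw [Finset.sum_comm]
  refine Finset.sum_congr rfl fun i _ => Finset.sum_congr rfl fun j _ => ?_
  rw [smul_comm]

/-- Single out one point of a set with `p + 1` elements. A proper subset avoiding it is a proper
subset of the rest or the whole rest; one containing it must meet the rest in a proper subset. -/
theorem properSum_succ (p : ℕ) (h : ℕ → ABPoly) :
    properSum (p + 1) h = properSum p h + properSum p (fun i => h (i + 1)) + h p := by
  have h1 : properSum p h + h p = ∑ i ∈ range (p + 1), p.choose i • h i := by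
    rw [Finset.sum_range_succ]; simp [properSum]
  have h2 : properSum (p + 1) h + h (p + 1) = ∑ i ∈ range (p + 2), (p + 1).choose i • h i := by
    rw [Finset.sum_range_succ]; simp [properSum]
  have h3 : properSum p (fun i => h (i + 1)) + h (p + 1)
      = ∑ i ∈ range (p + 1), p.choose i • h (i + 1) := by
    rw [Finset.sum_range_succ]; simp [properSum]
  have h4 : ∑ i ∈ range (p + 2), (p + 1).choose i • h i
      = (∑ i ∈ range (p + 1), p.choose i • h i) + ∑ i ∈ range (p + 1), p.choose i • h (i + 1) := by
    rw [Finset.sum_range_succ', Finset.sum_range_succ' (fun i => p.choose i • h i)]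
    rw [Finset.sum_range_succ (fun i => p.choose i • h (i + 1))]
    simp only [Nat.choose_succ_succ, add_smul, Finset.sum_add_distrib, Nat.choose_zero_right]
    rw [Finset.sum_range_succ, Finset.sum_range_succ]
    simp
    abel
  rw [h4, ← h1, ← h3] at h2
  rw [← sub_eq_zero] at h2 ⊢
  rw [← h2]
  abel

/-- A subset of a disjoint union is proper iff at least one of its two traces is proper, which gives
three cases. -/
theorem properSum_add_index (p q : ℕ) (h : ℕ → ABPoly) :
    properSum (p + q) h = properSum p (fun i => properSum q fun j => h (i + j))
      + properSum p (fun i => h (i + q)) + properSum q (fun j => h (p + j)) := by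
  induction q generalizing h with
  | zero => simp [properSum]
  | succ q ih =>
    rw [← add_assoc, properSum_succ, ih, ih]
    simp only [properSum_succ q, properSum_add, add_assoc]
    abel

/-! ### The `ab`-indices of a simplex and of the pieces of its boundary. -/

/-- A proper subset of size `k`, carrying the polynomial `x`, contributes to a poset of rank
`m + 1`. -/
def chainTerm (m k : ℕ) (x : ABPoly) : ABPoly :=
  if k = 0 then varE ^ m else x * varB * varE ^ (m - k)

/-- The `ab`-index of the Boolean algebra of rank `k`. -/
def boolPsi (k : ℕ) : ABPoly :=
  ∑ i : Fin k, k.choose i • chainTerm (k - 1) i (boolPsi i)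
termination_by k
decreasing_by exact i.2

/-- The contribution of a face with `k` vertices to a simplicial poset of rank `m + 1`. -/
def faceTerm (m k : ℕ) : ABPoly := chainTerm m k (boolPsi k)

theorem boolPsi_eq (k : ℕ) : boolPsi k = properSum k (faceTerm (k - 1)) := by
  rw [boolPsi, properSum, Finset.sum_range]
  rfl

theorem faceTerm_succ {m k : ℕ} (h : k ≤ m) : faceTerm (m + 1) k = faceTerm m k * varE := by
  unfold faceTerm chainTerm
  split_ifs with hk
  · rw [pow_succ]
  · rw [Nat.succ_sub h, pow_succ]; simp only [mul_assoc]

theorem faceTerm_self {m : ℕ} (h : m ≠ 0) : faceTerm m m = boolPsi m * varB := by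
  simp [faceTerm, chainTerm, h]

/-- The `ab`-index of the join of the boundaries of simplices with `p` and `q` vertices. -/
def joinPsi (p q : ℕ) : ABPoly :=
  properSum p fun i => properSum q fun j => faceTerm (p + q - 2) (i + j)

/-- The contribution of the interior faces of the union of `p` of the `p + q` facets of the boundary
of a simplex. -/
def intPsi (p q : ℕ) : ABPoly := properSum p fun i => faceTerm (p + q - 1) (i + q)

/-- The local index of the union of `p` of the `p + q` facets of the boundary of a simplex. -/
def locPsi (p q : ℕ) : ABPoly := intPsi p q - joinPsi p q * varB

theorem joinPsi_symm (p q : ℕ) : joinPsi p q = joinPsi q p := by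
  unfold joinPsi
  rw [properSum_comm]
  simp only [add_comm]

/-- This is a bistellar flip. Singling out the extra vertex on either side, the two joins have face
sums that agree except for the terms where a whole set of size `p`, respectively `q`, is used; these
are the two interior sums. -/
theorem joinPsi_succ_left {p q : ℕ} (hp : 1 ≤ p) :
    joinPsi (p + 1) q + intPsi p q = joinPsi p (q + 1) + intPsi q p := by
  unfold joinPsi intPsi
  rw [show p + 1 + q - 2 = p + q - 1 by omega, show p + (q + 1) - 2 = p + q - 1 by omega,
    show q + p - 1 = p + q - 1 by omega, properSum_succ]
  simp only [properSum_succ q, properSum_add]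
  simp only [add_comm p, add_assoc, add_comm 1]
  abel

theorem properSum_joinPsi {p q : ℕ} (hp : 1 ≤ p) (hq : 1 ≤ q) :
    properSum p (fun i => properSum q fun j => faceTerm (p + q - 1) (i + j))
      = joinPsi p q * varE := by
  unfold joinPsi
  rw [← properSum_mul]
  refine properSum_congr fun i hi => ?_
  rw [← properSum_mul]
  refine properSum_congr fun j hj => ?_
  rw [show p + q - 1 = p + q - 2 + 1 by omega, faceTerm_succ (by omega)]

/-- The boundary of a simplex is two complementary balls glued along a join. The common sphere has
rank one less, whence its factor `varE`. -/
theorem boolPsi_add {p q : ℕ} (hp : 1 ≤ p) (hq : 1 ≤ q) :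
    boolPsi (p + q) = intPsi p q + intPsi q p + joinPsi p q * varE := by
  rw [boolPsi_eq, properSum_add_index, properSum_joinPsi hp hq]
  unfold intPsi
  rw [add_comm q p]
  simp only [add_comm p]
  abel

/-- Single out one of the `p + 1` vertices: faces avoiding it give the first and the last term, the
last being the one face that misses only this vertex; faces containing it give the middle term. -/
theorem intPsi_succ_left {p q : ℕ} (hp : 1 ≤ p) :
    intPsi (p + 1) q = intPsi p q * varE + intPsi p (q + 1) + boolPsi (p + q) * varB := by
  unfold intPsi
  rw [properSum_succ, ← faceTerm_self (by omega), ← properSum_mul]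
  rw [show p + 1 + q - 1 = p + q by omega, show p + (q + 1) - 1 = p + q by omega]
  congr 2
  · refine properSum_congr fun i hi => ?_
    obtain ⟨m, hm⟩ : ∃ m, p + q = m + 1 := ⟨p + q - 1, by omega⟩
    rw [hm, faceTerm_succ (by omega)]
    rfl
  · simp only [add_assoc, add_comm 1]

/-- The model case of the whole lemma: one more facet is added to `p` facets of the boundary of a
simplex with `p + q + 1` vertices. -/
theorem locPsi_succ_left {p q : ℕ} (hp : 1 ≤ p) (hq : 1 ≤ q) :
    locPsi (p + 1) q - locPsi p (q + 1) = locPsi p q * (varA + varB)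
      + joinPsi p q * (varA * varB + varB * varA) := by
  have h1 := joinPsi_succ_left (q := q) hp
  have h1' : joinPsi (p + 1) q = joinPsi p (q + 1) + intPsi q p - intPsi p q :=
    eq_sub_of_add_eq h1
  unfold locPsi
  rw [intPsi_succ_left hp, h1', boolPsi_add hp hq]
  unfold varE
  noncomm_ring

theorem joinPsi_one {q : ℕ} : joinPsi 1 q = boolPsi q := by
  unfold joinPsi
  rw [properSum_one, boolPsi_eq]
  refine properSum_congr fun j _ => ?_
  rw [zero_add, show 1 + q - 2 = q - 1 by omega]

/-- For a single facet the only interior face is the facet itself, and its term is the boundary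
index times `varB`. -/
theorem locPsi_one {q : ℕ} (hq : 1 ≤ q) : locPsi 1 q = 0 := by
  unfold locPsi intPsi
  rw [joinPsi_one, properSum_one, zero_add, show 1 + q - 1 = q by omega,
    faceTerm_self (by omega), sub_self]

/-- The boundary of a simplex is the semisuspension of the union of all its facets but one, so its
index is a local index plus a boundary index times `c`. -/
theorem joinPsi_one_succ {q : ℕ} (hq : 1 ≤ q) :
    joinPsi 1 (q + 1) = locPsi q 1 + joinPsi 1 q * (varA + varB) := by
  have h := boolPsi_add (p := q) (q := 1) hq le_rfl
  have h0 := locPsi_one hq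
  unfold locPsi at h0 ⊢
  rw [joinPsi_one, h, joinPsi_symm q 1, sub_eq_zero.1 h0]
  unfold varE
  noncomm_ring

theorem joinPsi_one_one : joinPsi 1 1 = 1 := by
  rw [joinPsi_one, boolPsi_eq, properSum_one]
  simp [faceTerm, chainTerm]

theorem joinPsi_succ_left' {p q : ℕ} (hp : 1 ≤ p) :
    joinPsi (p + 1) q = joinPsi p (q + 1) + (locPsi q p - locPsi p q) := by
  have h1 := joinPsi_succ_left (q := q) hp
  unfold locPsi
  rw [joinPsi_symm q p, eq_sub_of_add_eq h1]
  abel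

/-! ### Nonnegativity of the `cd`-polynomials of these pieces. -/

/-- All coefficients of a `cd`-polynomial are nonnegative. -/
def CDNonneg (p : CDPoly) : Prop := ∀ w, 0 ≤ cdCoeff p w

theorem cdCoeff_add (p q : CDPoly) (w : FreeMonoid CDLetter) :
    cdCoeff (p + q) w = cdCoeff p w + cdCoeff q w := by
  simp [cdCoeff, MonoidAlgebra.coeff_add]

theorem cdCoeff_sub (p q : CDPoly) (w : FreeMonoid CDLetter) :
    cdCoeff (p - q) w = cdCoeff p w - cdCoeff q w := by
  rw [eq_sub_iff_add_eq, ← cdCoeff_add, sub_add_cancel]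

theorem cdCoeff_zero (w : FreeMonoid CDLetter) : cdCoeff 0 w = 0 := by
  simp [cdCoeff]

theorem CDLe_iff_nonneg_sub (p q : CDPoly) : CDLe p q ↔ CDNonneg (q - p) := by
  simp [CDLe, CDNonneg, cdCoeff_sub]

theorem CDNonneg.zero : CDNonneg 0 := fun w => (cdCoeff_zero w).ge

theorem CDNonneg.add {p q : CDPoly} (hp : CDNonneg p) (hq : CDNonneg q) : CDNonneg (p + q) :=
  fun w => by rw [cdCoeff_add]; exact add_nonneg (hp w) (hq w)

theorem CDNonneg.mul {p q : CDPoly} (hp : CDNonneg p) (hq : CDNonneg q) : CDNonneg (p * q) := by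
  classical
  intro w
  unfold cdCoeff
  rw [map_mul, MonoidAlgebra.coeff_mul]
  refine Finsupp.sum_nonneg fun u _ => Finsupp.sum_nonneg fun v _ => ?_
  split_ifs
  · exact mul_nonneg (hp u) (hq v)
  · exact le_rfl

theorem CDNonneg.one : CDNonneg 1 := by
  classical
  intro w
  unfold cdCoeff
  rw [map_one, MonoidAlgebra.one_def, MonoidAlgebra.coeff_single, Finsupp.single_apply]
  split_ifs <;> norm_num

theorem CDNonneg.letter (l : CDLetter) : CDNonneg (FreeAlgebra.ι ℤ l) := by
  classical
  intro w
  simp only [cdCoeff, FreeAlgebra.equivMonoidAlgebraFreeMonoid, AlgEquiv.ofAlgHom_apply,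
    FreeAlgebra.lift_ι_apply, MonoidAlgebra.of_apply, MonoidAlgebra.coeff_single, Finsupp.single_apply]
  split_ifs <;> norm_num

@[simp] theorem cdToAB_varC : cdToAB varC = varA + varB := by simp [cdToAB, varC]

@[simp] theorem cdToAB_varD : cdToAB varD = varA * varB + varB * varA := by simp [cdToAB, varD]

/-- An `ab`-polynomial that comes from a `cd`-polynomial with nonnegative coefficients. -/
def IsNonnegCD (x : ABPoly) : Prop := ∃ p, cdToAB p = x ∧ CDNonneg p

theorem IsNonnegCD.zero : IsNonnegCD 0 := ⟨0, map_zero _, .zero⟩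

theorem IsNonnegCD.one : IsNonnegCD 1 := ⟨1, map_one _, .one⟩

theorem IsNonnegCD.add {x y : ABPoly} : IsNonnegCD x → IsNonnegCD y → IsNonnegCD (x + y) := by
  rintro ⟨p, rfl, hp⟩ ⟨q, rfl, hq⟩
  exact ⟨p + q, map_add _ _ _, hp.add hq⟩

theorem IsNonnegCD.mul_c {x : ABPoly} : IsNonnegCD x → IsNonnegCD (x * (varA + varB)) := by
  rintro ⟨p, rfl, hp⟩
  exact ⟨p * varC, by simp, hp.mul (.letter _)⟩

theorem IsNonnegCD.mul_d {x : ABPoly} :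
    IsNonnegCD x → IsNonnegCD (x * (varA * varB + varB * varA)) := by
  rintro ⟨p, rfl, hp⟩
  exact ⟨p * varD, by simp, hp.mul (.letter _)⟩

/-- Telescoping: with the total number of vertices fixed, facets are added one at a time. -/
theorem isNonnegCD_locPsi_sub_of_succ {m : ℕ}
    (H : ∀ p q, 1 ≤ p → 1 ≤ q → p + q + 1 = m →
      IsNonnegCD (locPsi (p + 1) q - locPsi p (q + 1))) (k : ℕ) :
    ∀ p q, 1 ≤ p → 1 ≤ q → p + k + q = m →
      IsNonnegCD (locPsi (p + k) q - locPsi p (q + k)) := by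
  induction k with
  | zero => intro p q _ _ _; simpa using IsNonnegCD.zero
  | succ k ihk =>
    intro p q hp hq h
    have h1 := H (p + k) q (by omega) hq (by omega)
    have h2 := ihk p (q + 1) hp (by omega) (by omega)
    have h3 := h1.add h2
    rw [sub_add_sub_cancel] at h3
    rwa [show q + 1 + k = q + (k + 1) by omega] at h3

/-- The growth formula expresses local increments through smaller `L` and `J`, and the flip relation
expresses `J` through local increments with fewer vertices. Hence all three families are treated
together by induction on the number of vertices. -/
theorem isNonnegCD_locPsi_joinPsi (m : ℕ) :
    (∀ p q, 1 ≤ p → 1 ≤ q → p + q = m → IsNonnegCD (locPsi p q) ∧ IsNonnegCD (joinPsi p q)) ∧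
    ∀ p q, 1 ≤ p → 1 ≤ q → p + q + 1 = m →
      IsNonnegCD (locPsi (p + 1) q - locPsi p (q + 1)) := by
  induction m with
  | zero => exact ⟨fun p q hp hq h => by omega, fun p q hp hq h => by omega⟩
  | succ m ih =>
    obtain ⟨ih, ih'⟩ := ih
    have hstep : ∀ p q, 1 ≤ p → 1 ≤ q → p + q + 1 = m + 1 →
        IsNonnegCD (locPsi (p + 1) q - locPsi p (q + 1)) := by
      intro p q hp hq h
      rw [locPsi_succ_left hp hq]
      exact (ih p q hp hq (by omega)).1.mul_c.add (ih p q hp hq (by omega)).2.mul_d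
    have hloc : ∀ p q, 1 ≤ p → 1 ≤ q → p + q = m + 1 → IsNonnegCD (locPsi p q) := by
      intro p
      induction p with
      | zero => intro q hp; omega
      | succ p ihp =>
        intro q _ hq h
        rcases Nat.eq_zero_or_pos p with rfl | hp
        · rw [zero_add, locPsi_one hq]; exact .zero
        · have := (ihp (q + 1) hp (by omega) (by omega)).add (hstep p q hp hq (by omega))
          rwa [add_sub_cancel] at this
    -- Restricting to `p ≤ q` makes the correction `L(q,p) - L(p,q)` in the flip relation a sum of
    -- nonnegative increments; the other case follows by symmetry of the join.
    have hjoin : ∀ p q, 1 ≤ p → p ≤ q → p + q = m + 1 → IsNonnegCD (joinPsi p q) := by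
      intro p
      induction p with
      | zero => intro q hp; omega
      | succ p ihp =>
        intro q _ hq h
        rcases Nat.eq_zero_or_pos p with rfl | hp
        · obtain ⟨q, rfl⟩ : ∃ r, q = r + 1 := ⟨q - 1, by omega⟩
          rcases Nat.eq_zero_or_pos q with rfl | hq'
          · rw [zero_add, joinPsi_one_one]; exact .one
          · rw [zero_add, joinPsi_one_succ hq']
            exact (ih q 1 hq' le_rfl (by omega)).1.add (ih 1 q le_rfl hq' (by omega)).2.mul_c
        · rw [joinPsi_succ_left' hp]
          refine (ihp (q + 1) hp (by omega) (by omega)).add ?_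
          have := isNonnegCD_locPsi_sub_of_succ ih' (q - p) p p hp hp (by omega)
          rwa [show p + (q - p) = q by omega] at this
    refine ⟨fun p q hp hq h => ⟨hloc p q hp hq h, ?_⟩, hstep⟩
    rcases le_total p q with hpq | hpq
    · exact hjoin p q hp hpq h
    · rw [joinPsi_symm]; exact hjoin q p hq hpq (by omega)

theorem isNonnegCD_locPsi {p q : ℕ} (hp : 1 ≤ p) (hq : 1 ≤ q) : IsNonnegCD (locPsi p q) :=
  ((isNonnegCD_locPsi_joinPsi _).1 p q hp hq rfl).1

theorem isNonnegCD_joinPsi {p q : ℕ} (hp : 1 ≤ p) (hq : 1 ≤ q) : IsNonnegCD (joinPsi p q) :=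
  ((isNonnegCD_locPsi_joinPsi _).1 p q hp hq rfl).2

/-! ### Injectivity of the substitution into `ab`-polynomials. -/

/-- The substitution `c ↦ 2c`, `d ↦ 4d`. -/
def cdScale : CDPoly →ₐ[ℤ] CDPoly :=
  FreeAlgebra.lift ℤ fun l =>
    match l with
    | CDLetter.c => 2 * varC
    | CDLetter.d => 4 * varD

/-- A representation of `ABPoly` by matrices in which `a + b` and `ab + ba` act by `2c` and `4d`. -/
def abMatrix : ABPoly →ₐ[ℤ] Matrix (Fin 2) (Fin 2) CDPoly :=
  FreeAlgebra.lift ℤ fun l =>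
    match l with
    | ABLetter.a => !![varC, varC * varC - 2 * varD; 1, varC]
    | ABLetter.b => !![varC, -(varC * varC - 2 * varD); -1, varC]

/-- The two matrices are `cI + N` and `cI - N` with `N² = (c² - 2d)I`. Their sum is `2cI`, and in
the symmetrised product the mixed terms cancel even without commutativity, leaving `2c²I - 2N² =
4dI`. -/
theorem abMatrix_cdToAB (p : CDPoly) : abMatrix (cdToAB p) = Matrix.scalar (Fin 2) (cdScale p) := by
  let sc : CDPoly →ₐ[ℤ] Matrix (Fin 2) (Fin 2) CDPoly :=
    { Matrix.scalar (Fin 2) with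
      commutes' := fun r => by
        ext i j : 1
        rw [Matrix.algebraMap_matrix_apply]
        exact Matrix.diagonal_apply .. }
  have key : abMatrix.comp cdToAB = sc.comp cdScale := by
    ext l i j
    cases l
    · simp [abMatrix, cdToAB, cdScale, varA, varB, sc]
      fin_cases i <;> fin_cases j <;> simp <;> noncomm_ring
    · simp [abMatrix, cdToAB, cdScale, varA, varB, sc]
      fin_cases i <;> fin_cases j <;> simp <;> noncomm_ring
  exact DFunLike.congr_fun key p

/-- The scaling factor of a word under `cdScale`. -/
def scaleFactor : FreeMonoid CDLetter →* ℤ :=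
  FreeMonoid.lift fun l =>
    match l with
    | CDLetter.c => 2
    | CDLetter.d => 4

theorem scaleFactor_ne_zero (w : FreeMonoid CDLetter) : scaleFactor w ≠ 0 := by
  induction w using FreeMonoid.inductionOn' with
  | one => simp
  | of_mul l w ih =>
    rw [map_mul]
    refine mul_ne_zero ?_ ih
    cases l <;> simp [scaleFactor]

theorem cdCoeff_cdScale (p : CDPoly) (w : FreeMonoid CDLetter) :
    cdCoeff (cdScale p) w = scaleFactor w * cdCoeff p w := by
  classical
  let T := FreeAlgebra.equivMonoidAlgebraFreeMonoid (R := ℤ) (X := CDLetter)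
  have hmon : ∀ u : FreeMonoid CDLetter, T (cdScale (T.symm (MonoidAlgebra.single u 1)))
      = MonoidAlgebra.single u (scaleFactor u) := by
    intro u
    induction u using FreeMonoid.inductionOn' with
    | one =>
      rw [← MonoidAlgebra.one_def, map_one, map_one, map_one, map_one, MonoidAlgebra.one_def]
    | of_mul l u ih =>
      have : (MonoidAlgebra.single (FreeMonoid.of l * u) (1 : ℤ) : MonoidAlgebra ℤ _)
          = MonoidAlgebra.single (FreeMonoid.of l) 1 * MonoidAlgebra.single u 1 := by
        rw [MonoidAlgebra.single_mul_single, one_mul]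
      rw [this, map_mul, map_mul, map_mul, ih, map_mul, ← MonoidAlgebra.single_mul_single]
      congr 1
      have hl : T.symm (MonoidAlgebra.single (FreeMonoid.of l) 1) = FreeAlgebra.ι ℤ l := by
        rw [AlgEquiv.symm_apply_eq]
        simp [T, FreeAlgebra.equivMonoidAlgebraFreeMonoid]
      have hl' : T (FreeAlgebra.ι ℤ l) = MonoidAlgebra.single (FreeMonoid.of l) 1 := by
        rw [← hl, AlgEquiv.apply_symm_apply]
      rw [hl]
      cases l
      · simp only [cdScale, FreeAlgebra.lift_ι_apply, scaleFactor, FreeMonoid.lift_eval_of, varC]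
        rw [map_mul, hl', map_ofNat, ← Nat.cast_ofNat, ← nsmul_eq_mul, MonoidAlgebra.smul_single]
        simp
      · simp only [cdScale, FreeAlgebra.lift_ι_apply, scaleFactor, FreeMonoid.lift_eval_of, varD]
        rw [map_mul, hl', map_ofNat, ← Nat.cast_ofNat, ← nsmul_eq_mul, MonoidAlgebra.smul_single]
        simp
  obtain ⟨x, rfl⟩ := T.symm.surjective p
  have hT : ∀ y, cdCoeff y w = (T y).coeff w := fun _ => rfl
  rw [hT, hT, AlgEquiv.apply_symm_apply]
  induction x using MonoidAlgebra.induction_linear with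
  | zero => simp
  | add x y hx hy =>
    simp only [map_add, MonoidAlgebra.coeff_add, Finsupp.add_apply, mul_add, hx, hy]
  | single u r =>
    have : (MonoidAlgebra.single u r : MonoidAlgebra ℤ _) = r • MonoidAlgebra.single u 1 := by
      rw [MonoidAlgebra.smul_single, smul_eq_mul, mul_one]
    rw [this, map_smul, map_smul, map_smul, hmon]
    simp only [MonoidAlgebra.coeff_smul, Finsupp.smul_apply, MonoidAlgebra.coeff_single,
      Finsupp.single_apply, smul_eq_mul]
    split_ifs with h
    · rw [h]; ring
    · simp

/-- After the matrix representation the substitution only rescales every `cd`-monomial by a nonzero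
integer, so no coefficient is lost. -/
theorem cdToAB_injective : Function.Injective cdToAB := by
  rw [injective_iff_map_eq_zero]
  intro p hp
  have h := abMatrix_cdToAB p
  rw [hp, map_zero] at h
  have h0 : cdScale p = 0 := by
    have := congrFun (congrFun h 0) 0
    simpa using this.symm
  apply FreeAlgebra.equivMonoidAlgebraFreeMonoid.injective
  rw [map_zero]
  ext w
  have := cdCoeff_cdScale p w
  rw [h0, cdCoeff_zero] at this
  exact (mul_eq_zero.1 this.symm).resolve_left (scaleFactor_ne_zero w)

/-! ### Posets with an explicit rank function. -/

section

/-- A rank function of a poset with least and greatest element. -/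
structure IsRankFn {P : Type u} [PartialOrder P] (r : P → ℕ) (z t : P) : Prop where
  isBot : IsBot z
  isTop : IsTop t
  map_bot : r z = 0
  strictMono : StrictMono r
  step : ∀ x y, x < y → ∃ w, x < w ∧ w ≤ y ∧ r w = r x + 1

namespace IsRankFn
variable {P : Type u} [PartialOrder P] {r : P → ℕ} {z t : P}

theorem eq_bot_iff (h : IsRankFn r z t) (x : P) : r x = 0 ↔ x = z := by
  refine ⟨fun hx => ?_, fun hx => hx ▸ h.map_bot⟩
  by_contra hne
  have := h.strictMono (lt_of_le_of_ne (h.isBot x) (Ne.symm hne))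
  omega

theorem exists_pred [Finite P] (h : IsRankFn r z t) {x : P} (hx : x ≠ z) :
    ∃ y, y < x ∧ r x = r y + 1 := by
  obtain ⟨y, hy, hmax⟩ := Set.exists_max_image (Set.Iio x) r (Set.toFinite _)
    ⟨z, lt_of_le_of_ne (h.isBot x) (Ne.symm hx)⟩
  obtain ⟨w, hyw, hwx, hw⟩ := h.step y x hy
  refine ⟨y, hy, ?_⟩
  rcases hwx.lt_or_eq with hlt | rfl
  · have := hmax w hlt; omega
  · exact hw

/-- Strict monotonicity bounds the height from above; descending through elements of rank one less
bounds it from below. -/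
theorem rk_eq [Finite P] (h : IsRankFn r z t) (x : P) : rk x = r x := by
  have hle : ∀ x, Order.height x ≤ r x := fun x => by
    have := Order.height_le_height_apply_of_strictMono r h.strictMono x
    rwa [Order.height_nat] at this
  have hge : ∀ (m : ℕ) (x : P), r x = m → (m : ℕ∞) ≤ Order.height x := by
    intro m
    induction m with
    | zero => intro x _; simp
    | succ m ih =>
      intro x hx
      obtain ⟨y, hy, hxy⟩ := h.exists_pred (x := x) (fun hz => by
        rw [hz, h.map_bot] at hx; omega)
      have h1 := ih y (by omega)
      have h2 := Order.height_add_one_le hy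
      push_cast
      exact (add_le_add_left h1 1).trans h2
  unfold rk
  rw [le_antisymm (hle x) (hge _ x rfl), ENat.toNat_natCast]

theorem le_top (h : IsRankFn r z t) (x : P) : r x ≤ r t := h.strictMono.monotone (h.isTop x)

theorem posetRank_eq [Finite P] (h : IsRankFn r z t) : posetRank P = r t := by
  have : Nonempty P := ⟨z⟩
  unfold posetRank
  simp only [h.rk_eq]
  exact le_antisymm (ciSup_le h.le_top) (le_ciSup (Set.toFinite _).bddAbove t)

/-- On a maximal chain the rank function is injective and takes every value up to the rank of the
top. -/
theorem isGraded (h : IsRankFn r z t) : IsGraded P := by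
  refine ⟨r t, fun C => ?_⟩
  have hinj : Set.InjOn r (C : Set P) := by
    intro x hx y hy hxy
    rcases C.le_or_le hx hy with hle | hle
    · by_contra hne
      exact (h.strictMono (lt_of_le_of_ne hle hne)).ne hxy
    · by_contra hne
      exact (h.strictMono (lt_of_le_of_ne hle (Ne.symm hne))).ne hxy.symm
  have hmem : ∀ x : P, (∀ y ∈ C, x ≤ y ∨ y ≤ x) → x ∈ C := fun x hx =>
    Flag.mem_iff_forall_le_or_ge.2 fun y hy => hx y hy
  have hall : ∀ k ≤ r t, ∃ x ∈ C, r x = k := by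
    intro k
    induction k with
    | zero => exact fun _ => ⟨z, hmem z fun y _ => Or.inl (h.isBot y), h.map_bot⟩
    | succ k ih =>
      intro hk
      obtain ⟨x, hx, hxk⟩ := ih (by omega)
      -- Let `y` be the next element of the chain above `x`. An element `w` one rank above `x` and
      -- below `y` is comparable with the whole chain, so it belongs to it by maximality.
      let A : Set ℕ := r '' {y | y ∈ C ∧ x < y}
      have hA : A.Nonempty := ⟨r t, t, ⟨hmem t fun y _ => Or.inr (h.isTop y),
        lt_of_le_of_ne (h.isTop x) fun hxt => by rw [hxt] at hxk; omega⟩, rfl⟩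
      obtain ⟨y, ⟨hyC, hxy⟩, hyA⟩ := Nat.sInf_mem hA
      have hmin : ∀ w ∈ C, x < w → r y ≤ r w := fun w hw hxw => by
        rw [hyA]; exact Nat.sInf_le ⟨w, ⟨hw, hxw⟩, rfl⟩
      obtain ⟨w, hxw, hwy, hw⟩ := h.step x y hxy
      have hwC : w ∈ C := by
        refine hmem w fun v hv => ?_
        rcases C.le_or_le hv hx with hle | hle
        · exact Or.inr (hle.trans hxw.le)
        · rcases hle.lt_or_eq with hlt | rfl
          · left
            rcases C.le_or_le hv hyC with hvy | hyv
            · rcases hvy.lt_or_eq with hvy | rfl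
              · exact absurd (h.strictMono hvy) (hmin v hv hlt).not_gt
              · exact hwy
            · exact hwy.trans hyv
          · exact Or.inr hxw.le
      exact ⟨w, hwC, by omega⟩
  have himg : r '' (C : Set P) = (range (r t + 1) : Finset ℕ) := by
    ext k
    simp only [Set.mem_image, coe_range, Set.mem_Iio]
    constructor
    · rintro ⟨x, _, rfl⟩
      exact Nat.lt_succ_of_le (h.le_top x)
    · exact fun hk => hall k (Nat.le_of_lt_succ hk)
  rw [← hinj.ncard_image, himg, Set.ncard_coe_finset, card_range]

theorem isEulerian [Fintype P] (h : IsRankFn r z t)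
    [DecidableRel (α := P) (· ≤ ·)]
    (hb : ∀ x y : P, x < y → ∑ w : P, (if x ≤ w ∧ w ≤ y then (-1 : ℤ) ^ r w else 0) = 0) :
    IsEulerian P where
  finite := inferInstance
  exists_bot := ⟨z, h.isBot⟩
  exists_top := ⟨t, h.isTop⟩
  graded := h.isGraded
  balanced x y hxy := by
    classical
    have h1 := hb x y hxy
    rw [← Finset.sum_filter, ← Finset.sum_filter_add_sum_filter_not _ (fun w => Even (r w))] at h1
    rw [Finset.sum_congr rfl (g := fun _ => (1 : ℤ))
        (fun w hw => (mem_filter.1 hw).2.neg_one_pow),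
      Finset.sum_congr rfl (s₁ := filter (fun w => ¬ Even (r w)) _) (g := fun _ => (-1 : ℤ))
        (fun w hw => (Nat.not_even_iff_odd.1 (mem_filter.1 hw).2).neg_one_pow)] at h1
    simp only [sum_const, nsmul_eq_mul, mul_one, mul_neg, filter_filter] at h1
    rw [← sub_eq_add_neg, sub_eq_zero] at h1
    have h2 := Nat.cast_injective (R := ℤ) h1
    rw [← Set.ncard_coe_finset, ← Set.ncard_coe_finset] at h2
    simpa [h.rk_eq, Set.Icc, and_assoc] using h2

end IsRankFn

end

/-! ### From flag vectors to a recursion over chains. -/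

section

/-- The word `u_1 ⋯ u_n` with `u_i = b` if `i ∈ T` and `u_i = a - b` otherwise. -/
def chainWord (n : ℕ) (T : Finset ℕ) : ABPoly :=
  ((List.range n).map fun i => if i + 1 ∈ T then varB else varE).prod

theorem chainWord_succ (n : ℕ) (T : Finset ℕ) :
    chainWord (n + 1) T = chainWord n T * (if n + 1 ∈ T then varB else varE) := by
  simp [chainWord, List.range_succ]

theorem abWord_succ (n : ℕ) (T : Finset ℕ) :
    abWord (n + 1) T = abWord n T * (if n + 1 ∈ T then varB else varA) := by
  simp [abWord, List.range_succ]

theorem chainWord_congr {n : ℕ} {T T' : Finset ℕ} (h : ∀ i, 1 ≤ i → i ≤ n → (i ∈ T ↔ i ∈ T')) :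
    chainWord n T = chainWord n T' := by
  unfold chainWord
  congr 1
  refine List.map_congr_left fun i hi => ?_
  rw [List.mem_range] at hi
  simp only [h (i + 1) (by omega) (by omega)]

theorem abWord_congr {n : ℕ} {T T' : Finset ℕ} (h : ∀ i, 1 ≤ i → i ≤ n → (i ∈ T ↔ i ∈ T')) :
    abWord n T = abWord n T' := by
  unfold abWord
  congr 1
  refine List.map_congr_left fun i hi => ?_
  rw [List.mem_range] at hi
  simp only [h (i + 1) (by omega) (by omega)]

theorem chainWord_eq_pow {n : ℕ} {T : Finset ℕ} (h : ∀ i, 1 ≤ i → i ≤ n → i ∉ T) :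
    chainWord n T = varE ^ n := by
  induction n with
  | zero => simp [chainWord]
  | succ n ih =>
    rw [chainWord_succ, if_neg (h _ (by omega) le_rfl), pow_succ,
      ih fun i h1 h2 => h i h1 (by omega)]

theorem chainWord_split {n k : ℕ} {T : Finset ℕ} (hk : 1 ≤ k) (hkn : k ≤ n) (hkT : k ∈ T)
    (h : ∀ i, k < i → i ≤ n → i ∉ T) :
    chainWord n T = chainWord (k - 1) T * varB * varE ^ (n - k) := by
  induction n with
  | zero => omega
  | succ n ih =>
    rcases hkn.lt_or_eq with hlt | rfl
    · rw [chainWord_succ, if_neg (h _ hlt le_rfl), ih (by omega) fun i h1 h2 => h i h1 (by omega),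
        show n + 1 - k = n - k + 1 by omega, pow_succ, mul_assoc _ (varE ^ (n - k))]
    · rw [chainWord_succ, if_pos hkT, Nat.add_sub_cancel, Nat.sub_self, pow_zero, mul_one]

/-- Inclusion-exclusion over `T` amounts to replacing `a` by `a - b` in the words: at the last rank,
sets without it contribute `a` and sets with it contribute `b`, together with a correction `-b` for
the chains that skip it. -/
theorem sum_abWord_eq_sum_chainWord (n : ℕ) (f : Finset ℕ → ℤ) :
    ∑ T ∈ (Icc 1 n).powerset, (∑ R ∈ T.powerset, (-1) ^ (T \ R).card * f R) • abWord n T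
      = ∑ R ∈ (Icc 1 n).powerset, f R • chainWord n R := by
  induction n generalizing f with
  | zero => simp [abWord, chainWord]
  | succ n ih =>
    have hnot : n + 1 ∉ Icc 1 n := by simp
    have hI : Icc 1 (n + 1) = insert (n + 1) (Icc 1 n) := by
      ext i; simp only [mem_Icc, mem_insert]; omega
    rw [hI, sum_powerset_insert hnot, sum_powerset_insert hnot]
    have key : ∀ T ∈ (Icc 1 n).powerset, n + 1 ∉ T := fun T hT h => hnot (mem_powerset.1 hT h)
    have hins : ∀ T : Finset ℕ, ∀ i, 1 ≤ i → i ≤ n → (i ∈ insert (n + 1) T ↔ i ∈ T) :=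
      fun T i _ h2 => by simp only [mem_insert, or_iff_right_iff_imp]; omega
    have e1 : ∀ T ∈ (Icc 1 n).powerset,
        (∑ R ∈ T.powerset, (-1) ^ (T \ R).card * f R) • abWord (n + 1) T
        = ((∑ R ∈ T.powerset, (-1) ^ (T \ R).card * f R) • abWord n T) * varA := fun T hT => by
      rw [abWord_succ, if_neg (key T hT), smul_mul_assoc]
    have e2 : ∀ T ∈ (Icc 1 n).powerset,
        (∑ R ∈ (insert (n + 1) T).powerset, (-1) ^ (insert (n + 1) T \ R).card * f R)
            • abWord (n + 1) (insert (n + 1) T)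
        = ((∑ R ∈ T.powerset, (-1) ^ (T \ R).card * f (insert (n + 1) R)) • abWord n T) * varB
        - ((∑ R ∈ T.powerset, (-1) ^ (T \ R).card * f R) • abWord n T) * varB := fun T hT => by
      rw [abWord_succ, if_pos (mem_insert_self _ _), abWord_congr (hins T),
        sum_powerset_insert (key T hT), ← smul_mul_assoc, ← sub_mul, ← sub_smul]
      congr 2
      rw [add_comm, sub_eq_add_neg, ← sum_neg_distrib]
      congr 1
      · refine sum_congr rfl fun R hR => ?_
        rw [insert_sdiff_insert, sdiff_insert_of_notMem (key T hT)]
      · refine sum_congr rfl fun R hR => ?_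
        have hR' : n + 1 ∉ R := fun h => key T hT (mem_powerset.1 hR h)
        rw [insert_sdiff_of_notMem _ hR', card_insert_of_notMem
          (fun h => key T hT (mem_sdiff.1 h).1)]
        ring
    have e3 : ∀ T ∈ (Icc 1 n).powerset, f T • chainWord (n + 1) T
        = (f T • chainWord n T) * varE := fun T hT => by
      rw [chainWord_succ, if_neg (key T hT), smul_mul_assoc]
    have e4 : ∀ T ∈ (Icc 1 n).powerset, f (insert (n + 1) T) • chainWord (n + 1) (insert (n + 1) T)
        = (f (insert (n + 1) T) • chainWord n T) * varB := fun T _ => by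
      rw [chainWord_succ, if_pos (mem_insert_self _ _), chainWord_congr (hins T), smul_mul_assoc]
    rw [sum_congr rfl e1, sum_congr rfl e2, sum_congr rfl e3, sum_congr rfl e4, sum_sub_distrib]
    simp only [← sum_mul]
    rw [ih, ih fun R => f (insert (n + 1) R)]
    unfold varE
    noncomm_ring

open Classical in
/-- The chains with greatest element `x` that contain `z`. -/
def chainsTo {P : Type u} [PartialOrder P] [Fintype P] (z x : P) : Finset (Finset P) :=
  univ.filter fun C => IsChain (· ≤ ·) (C : Set P) ∧ z ∈ C ∧ x ∈ C ∧ ∀ y ∈ C, y ≤ x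

section
variable {P : Type u} [PartialOrder P] [Fintype P]

theorem mem_chainsTo {z x : P} {C : Finset P} :
    C ∈ chainsTo z x ↔ IsChain (· ≤ ·) (C : Set P) ∧ z ∈ C ∧ x ∈ C ∧ ∀ y ∈ C, y ≤ x := by
  simp [chainsTo]

-- Deleting `x` leaves a chain whose greatest element is some `y < x`, and this is reversible.
open Classical in
theorem chainsTo_eq_image {r : P → ℕ} {z t : P} (h : IsRankFn r z t) {x : P} (hx : x ≠ z) :
    chainsTo z x = ((univ.filter (· < x)).biUnion fun y => chainsTo z y).image (insert x) := by
  ext C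
  simp only [mem_image, mem_biUnion, mem_filter, mem_univ, true_and, mem_chainsTo]
  constructor
  · rintro ⟨hC, hz, hxC, hle⟩
    have hze : z ∈ C.erase x := mem_erase.2 ⟨hx.symm, hz⟩
    obtain ⟨y, hy, hmax⟩ := exists_max_image (C.erase x) r ⟨z, hze⟩
    have hyC := mem_erase.1 hy
    refine ⟨C.erase x, ⟨y, lt_of_le_of_ne (hle y hyC.2) hyC.1,
      hC.mono (by simp), hze, hy, fun w hw => ?_⟩, insert_erase hxC⟩
    rcases eq_or_ne w y with rfl | hne
    · exact le_rfl
    rcases hC (mem_of_mem_erase hw) hyC.2 hne with hwy | hyw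
    · exact hwy
    · exact absurd (h.strictMono (lt_of_le_of_ne hyw hne.symm)) (hmax w hw).not_gt
  · rintro ⟨C, ⟨y, hyx, hC, hz, hy, hle⟩, rfl⟩
    have hCx : ∀ w ∈ C, w ≤ x := fun w hw => (hle w hw).trans hyx.le
    refine ⟨?_, mem_insert_of_mem hz, mem_insert_self _ _, fun w hw => ?_⟩
    · rw [coe_insert]
      exact hC.insert fun w hw _ => Or.inr (hCx w hw)
    · rcases mem_insert.1 hw with rfl | hw
      · exact le_rfl
      · exact hCx w hw

open Classical in
/-- The sum of the words of the chains below `x`. -/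
def chainSum (r : P → ℕ) (z x : P) : ABPoly :=
  ∑ C ∈ chainsTo z x, chainWord (r x - 1) (C.image r)

-- Group the chains by their last element `y` before `x`. Ranks strictly between `y` and `x` are
-- empty and give powers of `varE`; the rank of `x` lies beyond the end of the word.
open Classical in
theorem chainSum_eq {r : P → ℕ} {z t : P} (h : IsRankFn r z t) {x : P} (hx : x ≠ z) :
    chainSum r z x = ∑ y ∈ univ.filter (· < x), chainTerm (r x - 1) (r y) (chainSum r z y) := by
  have hnot : ∀ C ∈ (univ.filter (· < x)).biUnion fun y => chainsTo z y, x ∉ C := by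
    intro C hC hxC
    simp only [mem_biUnion, mem_filter, mem_univ, true_and, mem_chainsTo] at hC
    obtain ⟨y, hy, -, -, -, hle⟩ := hC
    exact absurd (hle x hxC) hy.not_ge
  unfold chainSum
  rw [chainsTo_eq_image h hx, sum_image, sum_biUnion]
  · refine sum_congr rfl fun y hy => ?_
    have hyx : y < x := (mem_filter.1 hy).2
    have hr : r y < r x := h.strictMono hyx
    have hrle : ∀ C ∈ chainsTo z y, ∀ i, r y < i → i ≤ r x - 1 → i ∉ (insert x C).image r := by
      intro C hC i h1 h2 hi
      obtain ⟨w, hw, rfl⟩ := mem_image.1 hi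
      rcases mem_insert.1 hw with rfl | hw
      · omega
      · have := h.strictMono.monotone ((mem_chainsTo.1 hC).2.2.2 w hw); omega
    unfold chainTerm
    split_ifs with h0
    · have hy0 : y = z := (h.eq_bot_iff y).1 h0
      have : chainsTo z y = {{z}} := by
        ext C
        rw [mem_chainsTo, mem_singleton, hy0]
        constructor
        · rintro ⟨-, hz, -, hle⟩
          ext w
          rw [mem_singleton]
          exact ⟨fun hw => le_antisymm (hle w hw) (h.isBot w), fun hw => hw ▸ hz⟩
        · rintro rfl
          simp
      rw [this, sum_singleton, chainWord_eq_pow]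
      intro i h1 h2
      exact hrle {z} (by simp [this]) i (by omega) h2
    · rw [sum_mul, sum_mul]
      refine sum_congr rfl fun C hC => ?_
      have hyC := (mem_chainsTo.1 hC).2.2.1
      rw [chainWord_split (k := r y) (by omega) (by omega)
        (mem_image_of_mem r (mem_insert_of_mem hyC)) (hrle C hC)]
      congr 2
      refine chainWord_congr fun i h1 h2 => ?_
      rw [image_insert, mem_insert, or_iff_right]
      omega
  · intro y hy y' hy' hne
    simp only [Function.onFun]
    rw [disjoint_left]
    intro C hC hC'
    rw [mem_chainsTo] at hC hC'
    exact hne (le_antisymm (hC'.2.2.2 y hC.2.2.1) (hC.2.2.2 y' hC'.2.2.1))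
  · intro C hC C' hC' heq
    rw [← erase_insert (hnot C hC), ← erase_insert (hnot C' hC'), heq]

open Classical in
theorem flagF_eq_card {r : P → ℕ} {z t : P} (h : IsRankFn r z t) (T : Finset ℕ) :
    flagF P T =
      ((univ.filter fun C : Finset P => IsChain (· ≤ ·) (C : Set P) ∧ C.image r = T).card : ℤ) := by
  unfold flagF
  rw [← Set.ncard_coe_finset,
    ← Set.ncard_image_of_injective _ (Finset.coe_injective (α := P))]
  congr 2
  ext C
  simp only [Set.mem_ofPred_eq, coe_filter, mem_univ, true_and, Set.mem_image]
  have hrk : (rk : P → ℕ) = r := funext h.rk_eq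
  constructor
  · rintro ⟨hC, hT⟩
    refine ⟨C.toFinset, ⟨by simpa using hC, ?_⟩, by simp⟩
    apply Finset.coe_injective
    rw [coe_image, Set.coe_toFinset, ← hT, hrk]
  · rintro ⟨C, ⟨hC, rfl⟩, rfl⟩
    exact ⟨hC, by rw [hrk, coe_image]⟩

-- Chains with ranks in `[1, r t - 1]` avoid the bottom and the top. Adjoining both is a bijection
-- that changes no letter of the word.
open Classical in
theorem abIndex_eq_chainSum {r : P → ℕ} {z t : P} (h : IsRankFn r z t) (hzt : z ≠ t) :
    abIndex P = chainSum r z t := by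
  have hpos : 0 < r t := by
    have := h.strictMono (lt_of_le_of_ne (h.isBot t) hzt); omega
  unfold abIndex flagH
  rw [sum_abWord_eq_sum_chainWord, h.posetRank_eq]
  have hbounds : ∀ y : P, y ≠ z → y ≠ t → 1 ≤ r y ∧ r y ≤ r t - 1 := fun y hz ht => by
    have h1 := h.strictMono (lt_of_le_of_ne (h.isBot y) hz.symm)
    have h2 := h.strictMono (lt_of_le_of_ne (h.isTop y) ht)
    omega
  have e1 : ∀ R ∈ (Icc 1 (r t - 1)).powerset, flagF P R • chainWord (r t - 1) R
      = ∑ C ∈ univ.filter (fun C : Finset P => IsChain (· ≤ ·) (C : Set P) ∧ C.image r = R),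
          chainWord (r t - 1) (C.image r) := fun R _ => by
    rw [flagF_eq_card h, sum_congr rfl (g := fun _ => chainWord (r t - 1) R)
      fun C hC => by rw [(mem_filter.1 hC).2.2], sum_const, natCast_zsmul]
  rw [sum_congr rfl e1, ← sum_biUnion]
  · unfold chainSum
    refine sum_bij' (fun C _ => insert t (insert z C)) (fun C _ => (C.erase z).erase t) ?_ ?_ ?_ ?_ ?_
    · intro C hC
      simp only [mem_biUnion, mem_powerset, mem_filter, mem_univ, true_and] at hC
      obtain ⟨R, -, hC, -⟩ := hC
      rw [mem_chainsTo]
      refine ⟨?_, by simp, by simp, fun y _ => h.isTop y⟩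
      rw [coe_insert, coe_insert]
      exact (hC.insert fun w _ _ => Or.inl (h.isBot w)).insert fun w _ _ => Or.inr (h.isTop w)
    · intro C hC
      rw [mem_chainsTo] at hC
      simp only [mem_biUnion, mem_powerset, mem_filter, mem_univ, true_and]
      refine ⟨_, ?_, hC.1.mono fun w hw => ?_, rfl⟩
      · intro k hk
        obtain ⟨y, hy, rfl⟩ := mem_image.1 hk
        simp only [mem_erase] at hy
        exact mem_Icc.2 (hbounds y hy.2.1 hy.1)
      · simp only [coe_erase, Set.mem_sdiff] at hw
        exact hw.1.1
    · intro C hC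
      simp only [mem_biUnion, mem_powerset, mem_filter, mem_univ, true_and] at hC
      obtain ⟨R, hR, -, rfl⟩ := hC
      have hb : ∀ y ∈ C, 1 ≤ r y ∧ r y ≤ r t - 1 := fun y hy =>
        mem_Icc.1 (hR (mem_image_of_mem r hy))
      ext y
      simp only [mem_erase, mem_insert]
      constructor
      · rintro ⟨h1, h2, h3 | h3 | h3⟩
        · exact absurd h3 h1
        · exact absurd h3 h2
        · exact h3
      · intro hy
        have := hb y hy
        refine ⟨?_, ?_, Or.inr (Or.inr hy)⟩
        · rintro rfl; omega
        · rintro rfl; rw [h.map_bot] at this; omega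
    · intro C hC
      rw [mem_chainsTo] at hC
      ext y
      simp only [mem_erase, mem_insert]
      constructor
      · rintro (rfl | rfl | h3)
        · exact hC.2.2.1
        · exact hC.2.1
        · exact h3.2.2
      · intro hy
        by_cases h1 : y = t
        · exact Or.inl h1
        · by_cases h2 : y = z
          · exact Or.inr (Or.inl h2)
          · exact Or.inr (Or.inr ⟨h1, h2, hy⟩)
    · intro C _
      refine chainWord_congr fun i h1 h2 => ?_
      rw [image_insert, image_insert, mem_insert, mem_insert, h.map_bot]
      constructor
      · exact fun hi => Or.inr (Or.inr hi)
      · rintro (rfl | rfl | hi)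
        · omega
        · omega
        · exact hi
  · intro R _ R' _ hne
    simp only [Function.onFun]
    rw [disjoint_left]
    intro C hC hC'
    exact hne ((mem_filter.1 hC).2.2.symm.trans (mem_filter.1 hC').2.2)

open Classical in
/-- The `ab`-index satisfies the recursion over the last element of a chain, and is determined by
it. -/
theorem abIndex_eq {r : P → ℕ} {z t : P} (h : IsRankFn r z t) (hzt : z ≠ t) (ψ : P → ABPoly)
    (hψ : ∀ x, x ≠ z → ψ x = ∑ y, if y < x then chainTerm (r x - 1) (r y) (ψ y) else 0) :
    abIndex P = ψ t := by
  rw [abIndex_eq_chainSum h hzt]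
  have key : ∀ m x, r x = m → x ≠ z → chainSum r z x = ψ x := by
    intro m
    induction m using Nat.strong_induction_on with
    | _ m ih =>
      intro x hxm hx
      rw [chainSum_eq h hx, hψ x hx, sum_filter]
      refine sum_congr rfl fun y _ => ?_
      split_ifs with hyx
      -- The value of `ψ` at the bottom is arbitrary: `chainTerm` ignores it in rank `0`.
      · by_cases hy : y = z
        · simp [chainTerm, hy, h.map_bot]
        · rw [ih (r y) (hxm ▸ h.strictMono hyx) y rfl hy]
      · rfl
  exact key _ t rfl hzt.symm

end

end

/-! ### Enumerative balls: their boundary posets and semisuspensions. -/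

section

variable {V : Type u}

/-- `e` identifies `P` with the faces in `K`, a coatom above the faces in `D`, and a greatest
element. -/
structure IsSemiModel {P : Type u} [PartialOrder P] (K D : Finset (Finset V))
    (e : Option (Option K) ≃ P) : Prop where
  le_iff : ∀ s t : K, e (some (some s)) ≤ e (some (some t)) ↔ s.1 ⊆ t.1
  le_new : ∀ s : K, e (some (some s)) ≤ e (some none) ↔ s.1 ∈ D
  not_new_le : ∀ s : K, ¬ e (some none) ≤ e (some (some s))
  isTop : IsTop (e none)

theorem IsSemiModel.not_top_le {P : Type u} [PartialOrder P]
    {K D : Finset (Finset V)} {e : Option (Option K) ≃ P} (he : IsSemiModel K D e)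
    (s : Option K) : ¬ e none ≤ e (some s) := fun h => by
  have := e.injective (le_antisymm h (he.isTop _)); cases this

theorem IsSemiModel.lt_iff {P : Type u} [PartialOrder P]
    {K D : Finset (Finset V)} {e : Option (Option K) ≃ P} (he : IsSemiModel K D e) (s t : K) :
    e (some (some s)) < e (some (some t)) ↔ s.1 ⊂ t.1 := by
  rw [lt_iff_le_not_ge, he.le_iff, he.le_iff]; rfl

theorem IsSemiModel.lt_new {P : Type u} [PartialOrder P]
    {K D : Finset (Finset V)} {e : Option (Option K) ≃ P} (he : IsSemiModel K D e) (s : K) :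
    e (some (some s)) < e (some none) ↔ s.1 ∈ D := by
  rw [lt_iff_le_not_ge, he.le_new]; exact and_iff_left (he.not_new_le s)

theorem IsSemiModel.lt_top {P : Type u} [PartialOrder P]
    {K D : Finset (Finset V)} {e : Option (Option K) ≃ P} (he : IsSemiModel K D e) (s : Option K) :
    e (some s) < e none := lt_of_le_not_ge (he.isTop _) (he.not_top_le s)

variable [DecidableEq V]

/-- A finite complex `K` (given by all its faces) of dimension `n` whose face numbers behave like
those of a ball with boundary `D`. -/
structure IsBall (n : ℕ) (K D : Finset (Finset V)) : Prop where
  empty_mem : ∅ ∈ D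
  subset : D ⊆ K
  down : ∀ s ∈ K, ∀ t ⊆ s, t ∈ K
  down_bdry : ∀ s ∈ D, ∀ t ⊆ s, t ∈ D
  pure : ∀ s ∈ K, ∃ F ∈ K, s ⊆ F ∧ F.card = n + 1
  card_le : ∀ s ∈ K, s.card ≤ n + 1
  pure_bdry : ∀ s ∈ D, ∃ z ∈ D, s ⊆ z ∧ z.card = n
  card_bdry_le : ∀ s ∈ D, s.card ≤ n
  euler : ∀ s ∈ K, ∑ x ∈ K with s ⊆ x, (-1 : ℤ) ^ x.card = if s ∈ D then 0 else (-1) ^ (n + 1)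
  euler_bdry : ∀ s ∈ D, ∑ x ∈ D with s ⊆ x, (-1 : ℤ) ^ x.card = (-1) ^ n

/-- The contribution of the faces in `A` to the `ab`-index of a simplicial poset of rank `m + 1`. -/
def facePsi (m : ℕ) (A : Finset (Finset V)) : ABPoly := ∑ x ∈ A, faceTerm m x.card

theorem sum_neg_one_pow_card_Icc {s t : Finset V} (h : s ⊆ t) :
    ∑ x ∈ Icc s t, (-1 : ℤ) ^ x.card = if s = t then (-1) ^ t.card else 0 := by
  rw [Icc_eq_image_powerset h, sum_image]
  · have : ∀ y ∈ (t \ s).powerset, (-1 : ℤ) ^ (s ∪ y).card = (-1) ^ s.card * (-1) ^ y.card := by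
      intro y hy
      rw [card_union_of_disjoint, pow_add]
      exact disjoint_of_subset_right (mem_powerset.1 hy) disjoint_sdiff
    rw [sum_congr rfl this, ← mul_sum, sum_powerset_neg_one_pow_card]
    by_cases hst : s = t
    · simp [hst]
    · rw [if_neg hst, if_neg, mul_zero]
      rw [sdiff_eq_empty_iff_subset]
      exact fun h' => hst (h.antisymm h')
  · intro y hy y' hy' heq
    have hd : ∀ y ∈ (t \ s).powerset, Disjoint s y := fun y hy =>
      disjoint_of_subset_right (mem_powerset.1 hy) disjoint_sdiff
    have h1 := union_sdiff_cancel_left (hd y hy)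
    have h2 := union_sdiff_cancel_left (hd y' hy')
    rw [← h1, ← h2]
    exact congrArg (· \ s) heq

theorem sum_ite_interval_eq_zero {A : Finset (Finset V)} (hA : ∀ s ∈ A, ∀ t ⊆ s, t ∈ A)
    {s t : Finset V} (ht : t ∈ A) (hst : s ⊂ t) :
    ∑ x ∈ A, (if s ⊆ x ∧ x ⊆ t then (-1 : ℤ) ^ x.card else 0) = 0 := by
  rw [← sum_filter]
  have : A.filter (fun x => s ⊆ x ∧ x ⊆ t) = Icc s t := by
    ext x
    simp only [mem_filter, mem_Icc]
    exact ⟨fun h => h.2, fun h => ⟨hA t ht x h.2, h⟩⟩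
  rw [this, sum_neg_one_pow_card_Icc hst.subset, if_neg hst.ne]

theorem sum_ssubsets_card (h : ℕ → ABPoly) (x : Finset V) :
    ∑ y ∈ x.ssubsets, h y.card = properSum x.card h := by
  have h1 : ∑ y ∈ x.powerset, h y.card = properSum x.card h + h x.card := by
    rw [sum_powerset_apply_card, sum_range_succ]
    simp [properSum]
  rw [ssubsets, ← add_right_cancel_iff (a := h x.card), ← h1,
    sum_erase_add _ _ (mem_powerset_self x)]

theorem boolPsi_card_eq {A : Finset (Finset V)} (hA : ∀ s ∈ A, ∀ t ⊆ s, t ∈ A) {x : Finset V}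
    (hx : x ∈ A) :
    boolPsi x.card = ∑ y ∈ A, if y ⊂ x then faceTerm (x.card - 1) y.card else 0 := by
  rw [boolPsi_eq, ← sum_ssubsets_card, ← sum_filter]
  congr 1
  ext y
  simp only [mem_ssubsets, mem_filter]
  exact ⟨fun h => ⟨hA x hx y h.subset, h⟩, fun h => h.2⟩

namespace IsBall
variable {n : ℕ} {K D : Finset (Finset V)}

section Boundary
variable {P : Type u} [PartialOrder P]

theorem boundary_isRankFn (hB : IsBall n K D) (e : Option D ≃ P)
    (hle : ∀ s t : D, e (some s) ≤ e (some t) ↔ s.1 ⊆ t.1) (htop : IsTop (e none)) :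
    IsRankFn (fun x => (e.symm x).elim (n + 1) fun s => s.1.card) (e (some ⟨∅, hB.empty_mem⟩))
      (e none) where
  isBot x := by
    obtain ⟨x, rfl⟩ := e.surjective x
    cases x with
    | none => exact htop _
    | some s => exact (hle _ _).2 (empty_subset _)
  isTop := htop
  map_bot := by simp
  strictMono x y hxy := by
    obtain ⟨x, rfl⟩ := e.surjective x
    obtain ⟨y, rfl⟩ := e.surjective y
    cases x with
    | none => exact absurd (htop _) hxy.not_ge
    | some s =>
      cases y with
      | none => simpa using Nat.lt_succ_of_le (hB.card_bdry_le s s.2)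
      | some t =>
        rw [lt_iff_le_not_ge, hle, hle] at hxy
        simpa using card_lt_card hxy
  step x y hxy := by
    obtain ⟨x, rfl⟩ := e.surjective x
    obtain ⟨y, rfl⟩ := e.surjective y
    have hlt : ∀ s t : D, s.1 ⊂ t.1 → e (some s) < e (some t) := fun s t h => by
      rw [lt_iff_le_not_ge, hle, hle]; exact h
    cases x with
    | none => exact absurd (htop _) hxy.not_ge
    | some s =>
      have hex : ∀ t : D, s.1 ⊂ t.1 → ∃ w : D, s.1 ⊂ w.1 ∧ w.1 ⊆ t.1 ∧ w.1.card = s.1.card + 1 := by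
        intro t hst
        obtain ⟨v, hv, hvs⟩ := exists_of_ssubset hst
        exact ⟨⟨insert v s.1, hB.down_bdry t t.2 _ (insert_subset hv hst.subset)⟩,
          ssubset_insert hvs, insert_subset hv hst.subset, card_insert_of_notMem hvs⟩
      cases y with
      | none =>
        obtain ⟨z, hz, hsz, hzn⟩ := hB.pure_bdry s s.2
        rcases eq_or_ne s.1 z with rfl | hne
        · exact ⟨e none, hxy, le_rfl, by simp [hzn]⟩
        · obtain ⟨w, h1, h2, h3⟩ := hex ⟨z, hz⟩ (hsz.ssubset_of_ne hne)
          exact ⟨e (some w), hlt _ _ h1, htop _, by simpa using h3⟩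
      | some t =>
        rw [lt_iff_le_not_ge, hle, hle] at hxy
        obtain ⟨w, h1, h2, h3⟩ := hex t hxy
        exact ⟨e (some w), hlt _ _ h1, (hle _ _).2 h2, by simpa using h3⟩

/-- Intervals between two faces are Boolean; only those ending at the top need the Euler relation of
the boundary. -/
theorem boundary_isEulerian (hB : IsBall n K D) (e : Option D ≃ P)
    (hle : ∀ s t : D, e (some s) ≤ e (some t) ↔ s.1 ⊆ t.1) (htop : IsTop (e none)) :
    IsEulerian P := by
  classical
  have : Fintype P := Fintype.ofEquiv _ e
  refine (hB.boundary_isRankFn e hle htop).isEulerian fun x y hxy => ?_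
  obtain ⟨x, rfl⟩ := e.surjective x
  obtain ⟨y, rfl⟩ := e.surjective y
  have hnt : ∀ s : D, ¬ e none ≤ e (some s) := fun s h => by
    have := e.injective (le_antisymm h (htop _)); cases this
  rw [← e.sum_comp, Fintype.sum_option]
  simp only [Equiv.symm_apply_apply, Option.elim]
  cases x with
  | none => exact absurd (htop _) hxy.not_ge
  | some s =>
    cases y with
    | none =>
      simp only [hle, htop _, and_true, if_true]
      rw [sum_coe_sort D (fun w => if s.1 ⊆ w then (-1 : ℤ) ^ w.card else 0), ← sum_filter,
        hB.euler_bdry s s.2]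
      ring
    | some t =>
      rw [lt_iff_le_not_ge, hle, hle] at hxy
      simp only [hle, hnt, and_false, if_false, zero_add]
      rw [sum_coe_sort D (fun w => if s.1 ⊆ w ∧ w ⊆ t.1 then (-1 : ℤ) ^ w.card else 0)]
      exact sum_ite_interval_eq_zero hB.down_bdry t.2 hxy

theorem boundary_abIndex (hB : IsBall n K D) (e : Option D ≃ P)
    (hle : ∀ s t : D, e (some s) ≤ e (some t) ↔ s.1 ⊆ t.1) (htop : IsTop (e none)) :
    abIndex P = facePsi n D := by
  classical
  have : Fintype P := Fintype.ofEquiv _ e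
  have hnt : ∀ s : D, ¬ e none ≤ e (some s) := fun s h => by
    have := e.injective (le_antisymm h (htop _)); cases this
  have hlt : ∀ s t : D, e (some s) < e (some t) ↔ s.1 ⊂ t.1 := fun s t => by
    rw [lt_iff_le_not_ge, hle, hle]; rfl
  have hlt' : ∀ s : D, e (some s) < e none := fun s => lt_of_le_not_ge (htop _) (hnt s)
  have hnt' : ∀ s : D, ¬ e none < e (some s) := fun s h => hnt s h.le
  rw [abIndex_eq (hB.boundary_isRankFn e hle htop) (by simp)
    (fun x => (e.symm x).elim (facePsi n D) fun s => boolPsi s.1.card)]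
  · simp
  · intro x hx
    obtain ⟨x, rfl⟩ := e.surjective x
    rw [← e.sum_comp, Fintype.sum_option]
    simp only [Equiv.symm_apply_apply, Option.elim]
    cases x with
    | none =>
      simp only [lt_irrefl, if_false, hlt', if_true, zero_add, Nat.add_sub_cancel]
      exact (sum_coe_sort D fun w => faceTerm n w.card).symm
    | some s =>
      simp only [hnt', if_false, zero_add, hlt]
      rw [boolPsi_card_eq hB.down_bdry s.2]
      exact (sum_coe_sort D fun w => if w ⊂ s.1 then faceTerm (s.1.card - 1) w.card else 0).symm

end Boundary

section Suspension
variable {P : Type u} [PartialOrder P]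

/-- The ranks of the elements of the semisuspension. -/
def semiRank (n : ℕ) (K : Finset (Finset V)) : Option (Option K) → ℕ
  | none => n + 2
  | some none => n + 1
  | some (some s) => s.1.card

/-- The `ab`-indices of the lower intervals of the semisuspension. -/
def semiPsi (n : ℕ) (K D : Finset (Finset V)) : Option (Option K) → ABPoly
  | none => facePsi (n + 1) K + facePsi n D * varB
  | some none => facePsi n D
  | some (some s) => boolPsi s.1.card

theorem semi_isRankFn (hB : IsBall n K D) {e : Option (Option K) ≃ P} (he : IsSemiModel K D e) :
    IsRankFn (fun x => semiRank n K (e.symm x))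
      (e (some (some ⟨∅, hB.subset hB.empty_mem⟩))) (e none) where
  isBot x := by
    obtain ⟨x, rfl⟩ := e.surjective x
    match x with
    | none => exact he.isTop _
    | some none => exact (he.le_new _).2 hB.empty_mem
    | some (some s) => exact (he.le_iff _ _).2 (empty_subset _)
  isTop := he.isTop
  map_bot := by simp [semiRank]
  strictMono x y hxy := by
    obtain ⟨x, rfl⟩ := e.surjective x
    obtain ⟨y, rfl⟩ := e.surjective y
    simp only [Equiv.symm_apply_apply]
    match x, y with
    | none, _ => exact absurd (he.isTop _) hxy.not_ge
    | some none, none => simp [semiRank]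
    | some none, some none => exact absurd hxy (lt_irrefl _)
    | some none, some (some t) => exact absurd hxy.le (he.not_new_le t)
    | some (some s), none =>
      have := hB.card_le s s.2
      simp only [semiRank]; omega
    | some (some s), some none =>
      have := hB.card_bdry_le s ((he.lt_new s).1 hxy)
      simp only [semiRank]; omega
    | some (some s), some (some t) => exact card_lt_card ((he.lt_iff s t).1 hxy)
  step x y hxy := by
    obtain ⟨x, rfl⟩ := e.surjective x
    obtain ⟨y, rfl⟩ := e.surjective y
    have hex : ∀ s t : K, s.1 ⊂ t.1 → ∃ w : K, s.1 ⊂ w.1 ∧ w.1 ⊆ t.1 ∧ w.1.card = s.1.card + 1 := by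
      intro s t hst
      obtain ⟨v, hv, hvs⟩ := exists_of_ssubset hst
      exact ⟨⟨insert v s.1, hB.down t t.2 _ (insert_subset hv hst.subset)⟩,
        ssubset_insert hvs, insert_subset hv hst.subset, card_insert_of_notMem hvs⟩
    match x, y with
    | none, _ => exact absurd (he.isTop _) hxy.not_ge
    | some none, none => exact ⟨e none, hxy, le_rfl, by simp [semiRank]⟩
    | some none, some none => exact absurd hxy (lt_irrefl _)
    | some none, some (some t) => exact absurd hxy.le (he.not_new_le t)
    | some (some s), none =>
      obtain ⟨F, hF, hsF, hFn⟩ := hB.pure s s.2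
      rcases eq_or_ne s.1 F with rfl | hne
      · exact ⟨e none, hxy, le_rfl, by simp [semiRank, hFn]⟩
      · obtain ⟨w, h1, h2, h3⟩ := hex s ⟨F, hF⟩ (hsF.ssubset_of_ne hne)
        exact ⟨_, (he.lt_iff s w).2 h1, he.isTop _, by simpa [semiRank] using h3⟩
    | some (some s), some none =>
      obtain ⟨z, hz, hsz, hzn⟩ := hB.pure_bdry s ((he.lt_new s).1 hxy)
      rcases eq_or_ne s.1 z with rfl | hne
      · exact ⟨e (some none), hxy, le_rfl, by simp [semiRank, hzn]⟩
      · obtain ⟨w, h1, h2, h3⟩ := hex s ⟨z, hB.subset hz⟩ (hsz.ssubset_of_ne hne)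
        exact ⟨_, (he.lt_iff s w).2 h1, (he.le_new w).2 (hB.down_bdry z hz _ h2),
          by simpa [semiRank] using h3⟩
    | some (some s), some (some t) =>
      obtain ⟨w, h1, h2, h3⟩ := hex s t ((he.lt_iff s t).1 hxy)
      exact ⟨_, (he.lt_iff s w).2 h1, (he.le_iff w t).2 h2, by simpa [semiRank] using h3⟩

/-- Below the top, the new coatom compensates the vanishing alternating sum at a boundary face,
while at an interior face the sum already cancels the top. Below the new coatom the Euler relation
of the boundary applies, and intervals between faces are Boolean. -/
theorem semi_isEulerian (hB : IsBall n K D) {e : Option (Option K) ≃ P} (he : IsSemiModel K D e) :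
    IsEulerian P := by
  classical
  have : Fintype P := Fintype.ofEquiv _ e
  refine (hB.semi_isRankFn he).isEulerian fun x y hxy => ?_
  obtain ⟨x, rfl⟩ := e.surjective x
  obtain ⟨y, rfl⟩ := e.surjective y
  rw [← e.sum_comp, Fintype.sum_option, Fintype.sum_option]
  simp only [Equiv.symm_apply_apply, semiRank]
  match x, y with
  | none, _ => exact absurd (he.isTop _) hxy.not_ge
  | some none, none =>
    simp only [he.isTop _, he.not_new_le, le_refl, and_true, if_true, if_false, sum_const_zero]
    ring
  | some none, some none => exact absurd hxy (lt_irrefl _)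
  | some none, some (some t) => exact absurd hxy.le (he.not_new_le t)
  | some (some s), none =>
    simp only [he.isTop _, he.le_iff, he.le_new, and_true, if_true]
    rw [sum_coe_sort K (fun w => if s.1 ⊆ w then (-1 : ℤ) ^ w.card else 0), ← sum_filter,
      hB.euler s s.2]
    split_ifs <;> ring
  | some (some s), some none =>
    have hs := (he.lt_new s).1 hxy
    simp only [he.isTop _, he.le_iff, he.le_new, he.not_top_le, le_refl, hs, and_true, and_false,
      if_true, if_false]
    rw [sum_coe_sort K (fun w => if s.1 ⊆ w ∧ w ∈ D then (-1 : ℤ) ^ w.card else 0), ← sum_filter]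
    have : K.filter (fun w => s.1 ⊆ w ∧ w ∈ D) = D.filter (fun w => s.1 ⊆ w) := by
      ext w
      simp only [mem_filter]
      exact ⟨fun h => ⟨h.2.2, h.2.1⟩, fun h => ⟨hB.subset h.1, h.2, h.1⟩⟩
    rw [this, hB.euler_bdry s hs]
    ring
  | some (some s), some (some t) =>
    simp only [he.le_iff, he.not_top_le, he.not_new_le, and_false, if_false, zero_add]
    rw [sum_coe_sort K (fun w => if s.1 ⊆ w ∧ w ⊆ t.1 then (-1 : ℤ) ^ w.card else 0)]
    exact sum_ite_interval_eq_zero hB.down t.2 ((he.lt_iff s t).1 hxy)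

theorem semi_abIndex (hB : IsBall n K D) {e : Option (Option K) ≃ P} (he : IsSemiModel K D e) :
    abIndex P = facePsi (n + 1) K + facePsi n D * varB := by
  classical
  have : Fintype P := Fintype.ofEquiv _ e
  have hnt : ∀ s : Option K, ¬ e none < e (some s) := fun s h => he.not_top_le s h.le
  have hnn : ∀ s : K, ¬ e (some none) < e (some (some s)) := fun s h => he.not_new_le s h.le
  rw [abIndex_eq (hB.semi_isRankFn he) (by simp) (fun x => semiPsi n K D (e.symm x))]
  · simp [semiPsi]
  · intro x hx
    obtain ⟨x, rfl⟩ := e.surjective x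
    rw [← e.sum_comp, Fintype.sum_option, Fintype.sum_option]
    simp only [Equiv.symm_apply_apply, semiRank, semiPsi]
    match x with
    | none =>
      simp only [lt_irrefl, if_false, he.lt_top, if_true, zero_add,
        show n + 2 - 1 = n + 1 by omega]
      refine Eq.trans ?_ (congrArg (_ + ·) (sum_coe_sort K fun w => faceTerm (n + 1) w.card).symm)
      -- The new coatom has the maximal rank `n + 1` below the top, so it contributes the boundary
      -- index times `varB` with no power of `varE`.
      simp [chainTerm, facePsi, add_comm]
    | some none =>
      simp only [lt_irrefl, if_false, hnt, he.lt_new, zero_add,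
        Nat.add_sub_cancel]
      refine Eq.trans ?_ (sum_coe_sort K fun w => if w ∈ D then faceTerm n w.card else 0).symm
      rw [← sum_filter, filter_mem_eq_inter, inter_eq_right.2 hB.subset]
      rfl
    | some (some s) =>
      simp only [hnt, hnn, if_false, zero_add, he.lt_iff]
      rw [boolPsi_card_eq hB.down s.2]
      exact (sum_coe_sort K fun w => if w ⊂ s.1 then faceTerm (s.1.card - 1) w.card else 0).symm

end Suspension
end IsBall

end

/-! ### Transfer to `P1` of a simplicial complex. -/

section

variable {V : Type u} [DecidableEq V]

namespace IsBall
variable {n : ℕ} {K D : Finset (Finset V)} {L : PreAbstractSimplicialComplex V}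

theorem ncard_Ici_coe (hL : ∀ s, s ∈ allFaces L ↔ s ∈ K)
    (s : {s : Finset V // s ∈ allFaces L}) :
    (Set.Ici (s : P1 L)).ncard = (K.filter (s.1 ⊆ ·)).card + 1 := by
  let A : Set {s : Finset V // s ∈ allFaces L} := {x | s.1 ⊆ x.1}
  have hA : Subtype.val '' A = (K.filter (s.1 ⊆ ·) : Finset (Finset V)) := by
    ext x
    simp only [A, Set.mem_image, Set.mem_ofPred_eq, Subtype.exists, exists_and_left, exists_prop,
      exists_eq_right_right, coe_filter, ← hL]
    exact and_comm
  have hAcard : A.ncard = (K.filter (s.1 ⊆ ·)).card := by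
    rw [← Set.ncard_coe_finset, ← hA, Set.ncard_image_of_injective _ Subtype.val_injective]
  have hfin : A.Finite := Set.Finite.of_finite_image (f := Subtype.val)
    (hA ▸ Finset.finite_toSet _) Subtype.val_injective.injOn
  have hI : Set.Ici (s : P1 L) = insert ⊤ ((fun x : {s : Finset V // s ∈ allFaces L} => (x : P1 L)) '' A) := by
    ext x
    cases x with
    | top => simp
    | coe x =>
      simp only [Set.mem_Ici, WithTop.coe_le_coe, Set.mem_insert_iff, WithTop.coe_ne_top, false_or,
        Set.mem_image, WithTop.coe_inj, exists_eq_right]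
      rfl
  rw [hI, Set.ncard_insert_of_notMem (by simp) (hfin.image _),
    Set.ncard_image_of_injective _ WithTop.coe_injective, hAcard]

/-- The order-theoretic boundary agrees with the prescribed `D`. If `[z, 1]` has three elements, two
faces contain `z`, so its alternating sum is even and `z` is not interior. Conversely, the Euler
relation says that a boundary ridge lies in exactly one facet. -/
theorem onBoundary_iff (hB : IsBall n K D) (hL : ∀ s, s ∈ allFaces L ↔ s ∈ K)
    (s : {s : Finset V // s ∈ allFaces L}) : OnBoundary (s : P1 L) ↔ s.1 ∈ D := by
  constructor
  · rintro ⟨z, hz, h3⟩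
    cases z with
    | top => rw [Set.Ici_top, Set.ncard_singleton] at h3; omega
    | coe z =>
      rw [ncard_Ici_coe hL] at h3
      have hsz : s ≤ z := WithTop.coe_le_coe.1 hz
      refine hB.down_bdry z.1 ?_ _ hsz
      have he := hB.euler z.1 ((hL _).1 z.2)
      by_contra hzD
      rw [if_neg hzD] at he
      -- Modulo `2` the sum counts the two faces containing `z`, while an interior face would
      -- require an odd value.
      have hpar := congrArg (Int.cast : ℤ → ZMod 2) he
      have hone : ((-1 : ℤ) : ZMod 2) = 1 := by decide
      rw [Int.cast_sum] at hpar
      simp only [Int.cast_pow, hone, one_pow, sum_const, show (K.filter (z.1 ⊆ ·)).card = 2 by omega]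
        at hpar
      exact absurd hpar (by decide)
  · intro hs
    obtain ⟨z, hz, hsz, hzn⟩ := hB.pure_bdry _ hs
    have hzK := hB.subset hz
    refine ⟨((⟨z, (hL z).2 hzK⟩ : {s : Finset V // s ∈ allFaces L}) : P1 L),
      WithTop.coe_le_coe.2 hsz, ?_⟩
    rw [ncard_Ici_coe hL]
    have he := hB.euler z hzK
    rw [if_pos hz] at he
    have hmem : z ∈ K.filter (z ⊆ ·) := mem_filter.2 ⟨hzK, Subset.rfl⟩
    -- Faces strictly above the ridge `z` have `n + 1` vertices, so all their signs are equal and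
    -- the relation counts them.
    rw [← add_sum_erase _ _ hmem, sum_congr rfl (g := fun _ => (-1 : ℤ) ^ (n + 1))] at he
    · rw [sum_const, hzn, pow_succ, nsmul_eq_mul] at he
      have h1 : (((K.filter (z ⊆ ·)).erase z).card : ℤ) = 1 := by
        rcases neg_one_pow_eq_or ℤ n with h | h <;> rw [h] at he <;> linarith
      have := card_erase_add_one hmem
      have h2 : ((K.filter (z ⊆ ·)).erase z).card = 1 := by exact_mod_cast h1
      simp only
      omega
    · intro x hx
      simp only [mem_erase, mem_filter] at hx
      have h1 := card_lt_card (hx.2.2.ssubset_of_ne (Ne.symm hx.1))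
      have h2 := hB.card_le x hx.2.1
      rw [show x.card = n + 1 by omega]

/-- The semisuspension of `P1 L` in terms of the faces of `L`. -/
def semiEquiv (hL : ∀ s, s ∈ allFaces L ↔ s ∈ K) :
    Option (Option K) ≃ Semisuspension (P1 L) where
  toFun
    | none => .old ⊤
    | some none => .new
    | some (some s) => .old ((⟨s.1, (hL _).2 s.2⟩ : {s : Finset V // s ∈ allFaces L}) : P1 L)
  invFun
    | .old none => none
    | .old (some s) => some (some ⟨s.1, (hL _).1 s.2⟩)
    | .new => some none
  left_inv x := by
    match x with
    | none => rfl
    | some none => rfl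
    | some (some s) => rfl
  right_inv x := by
    match x with
    | .old none => rfl
    | .old (some s) => rfl
    | .new => rfl

theorem isSemiModel (hB : IsBall n K D) (hL : ∀ s, s ∈ allFaces L ↔ s ∈ K) :
    IsSemiModel K D (semiEquiv hL) where
  le_iff s t := WithTop.coe_le_coe
  le_new s := hB.onBoundary_iff hL _
  not_new_le s h := by
    have h' : IsTop ((⟨s.1, (hL _).2 s.2⟩ : {s : Finset V // s ∈ allFaces L}) : P1 L) := h
    exact absurd (top_le_iff.1 (h' ⊤)) (WithTop.coe_ne_top)
  isTop x := by
    match x with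
    | .old x => exact (le_top : x ≤ (⊤ : P1 L))
    | .new => exact (fun x => le_top : IsTop (⊤ : P1 L))

/-- The boundary of `P1 L` in terms of the boundary faces of `L`. -/
def boundaryEquiv (hB : IsBall n K D) (hL : ∀ s, s ∈ allFaces L ↔ s ∈ K) :
    Option D ≃ BoundaryPoset (P1 L) where
  toFun
    | none => ⟨⊤, Or.inr isTop_top⟩
    | some s => ⟨((⟨s.1, (hL _).2 (hB.subset s.2)⟩ : {s : Finset V // s ∈ allFaces L}) : P1 L),
        Or.inl ((hB.onBoundary_iff hL _).2 s.2)⟩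
  invFun
    | ⟨none, _⟩ => none
    | ⟨some s, h⟩ => some ⟨s.1, (hB.onBoundary_iff hL s).1 (h.resolve_right fun h' =>
        absurd (top_le_iff.1 (h' ⊤)) WithTop.coe_ne_top)⟩
  left_inv x := by
    match x with
    | none => rfl
    | some s => rfl
  right_inv x := by
    match x with
    | ⟨none, _⟩ => rfl
    | ⟨some s, _⟩ => rfl

theorem boundaryEquiv_le (hB : IsBall n K D) (hL : ∀ s, s ∈ allFaces L ↔ s ∈ K) (s t : D) :
    hB.boundaryEquiv hL (some s) ≤ hB.boundaryEquiv hL (some t) ↔ s.1 ⊆ t.1 :=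
  WithTop.coe_le_coe

theorem boundaryEquiv_isTop (hB : IsBall n K D) (hL : ∀ s, s ∈ allFaces L ↔ s ∈ K) :
    IsTop (hB.boundaryEquiv hL none) := fun x => (le_top : x.1 ≤ (⊤ : P1 L))

/-- Removing the added coatom from the Eulerian semisuspension gives back the original poset. -/
theorem isNearEulerian (hB : IsBall n K D) (hL : ∀ s, s ∈ allFaces L ↔ s ∈ K) :
    IsNearEulerian (P1 L) := by
  have he := hB.isSemiModel hL
  refine ⟨Semisuspension (P1 L), inferInstance, .new, .old ⊤, hB.semi_isEulerian he, he.isTop,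
    ⟨he.lt_top none, fun {y} h1 h2 => ?_⟩, ⟨?_⟩⟩
  · obtain ⟨y, rfl⟩ := (semiEquiv hL).surjective y
    match y with
    | none => exact absurd h2 (lt_irrefl _)
    | some none => exact absurd h1 (lt_irrefl _)
    | some (some s) => exact he.not_new_le s h1.le
  · exact
      { toFun := fun x => ⟨.old x, by simp⟩
        invFun := fun y =>
          match y with
          | ⟨.old x, _⟩ => x
          | ⟨.new, h⟩ => absurd rfl h
        left_inv := fun x => rfl
        right_inv := fun y =>
          match y with
          | ⟨.old x, _⟩ => rfl
          | ⟨.new, h⟩ => absurd rfl h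
        map_rel_iff' := Iff.rfl }

end IsBall

theorem HasCDIndex.of_cdToAB {P : Type u} [PartialOrder P] (h : IsEulerian P) {φ : CDPoly}
    (hφ : cdToAB φ = abIndex P) : HasCDIndex P ∧ cdIndex P = φ := by
  have hex : ∃ φ, IsCDIndex P φ := ⟨φ, hφ⟩
  refine ⟨⟨h, φ, hφ, fun ψ hψ => cdToAB_injective (hψ.trans hφ.symm)⟩, ?_⟩
  rw [cdIndex, dif_pos hex]
  exact cdToAB_injective (hex.choose_spec.trans hφ.symm)

/-- The local index of a ball as an `ab`-polynomial. -/
def ballLoc (n : ℕ) (K D : Finset (Finset V)) : ABPoly :=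
  facePsi (n + 1) K + facePsi n D * varB - facePsi n D * (varA + varB)

theorem IsBall.hasLocalCDIndex {n : ℕ} {K D : Finset (Finset V)} {L : PreAbstractSimplicialComplex V}
    (hB : IsBall n K D) (hL : ∀ s, s ∈ allFaces L ↔ s ∈ K) {l β : CDPoly}
    (hl : cdToAB l = ballLoc n K D) (hβ : cdToAB β = facePsi n D) :
    HasLocalCDIndex (P1 L) ∧ localCDIndex (P1 L) = l ∧ cdIndex (BoundaryPoset (P1 L)) = β := by
  have h1 := HasCDIndex.of_cdToAB (hB.boundary_isEulerian _ (hB.boundaryEquiv_le hL)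
    (hB.boundaryEquiv_isTop hL)) (hβ.trans (hB.boundary_abIndex _ (hB.boundaryEquiv_le hL)
    (hB.boundaryEquiv_isTop hL)).symm)
  have h2 := HasCDIndex.of_cdToAB (φ := l + β * varC) (hB.semi_isEulerian (hB.isSemiModel hL)) (by
    rw [hB.semi_abIndex (hB.isSemiModel hL), map_add, map_mul, hl, hβ, cdToAB_varC, ballLoc,
      sub_add_cancel])
  refine ⟨⟨hB.isNearEulerian hL, h2.1, h1.1⟩, ?_, h1.2⟩
  rw [localCDIndex, h1.2, h2.2, add_sub_cancel_right]

end

/-! ### The Euler–Poincaré formula and the Euler relations of a Gorenstein complex. -/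

section

variable {V : Type u} [LinearOrder V]

theorem bdry_sign_swap {t : Finset V} {u v : V} (hu : u ∉ t) (huv : u < v) :
    (-1 : ℝ) ^ (t.filter (· < v)).card * (-1) ^ ((insert v t).filter (· < u)).card
      = - ((-1 : ℝ) ^ (t.filter (· < u)).card * (-1) ^ ((insert u t).filter (· < v)).card) := by
  rw [filter_insert, if_neg huv.not_gt, filter_insert, if_pos huv,
    card_insert_of_notMem (by simp [hu]), pow_succ]
  ring

theorem finrank_chains {K : PreAbstractSimplicialComplex V} {A : Finset (Finset V)}
    (hA : ∀ s, s ∈ allFaces K ↔ s ∈ A) (j : ℕ) :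
    Module.finrank ℝ (chains K j) = (A.filter (·.card = j)).card := by
  classical
  let e : chains K j ≃ₗ[ℝ] ({s // s ∈ A.filter (·.card = j)} → ℝ) :=
    { toFun := fun f s => f.1 s.1
      map_add' := fun f g => rfl
      map_smul' := fun r f => rfl
      invFun := fun g => ⟨fun s => if h : s ∈ A.filter (·.card = j) then g ⟨s, h⟩ else 0,
        fun s hs => by
          by_cases h : s ∈ A.filter (·.card = j)
          · exact ⟨(hA s).2 (mem_filter.1 h).1, (mem_filter.1 h).2⟩
          · exact absurd (dif_neg h) hs⟩
      left_inv := fun f => by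
        ext s
        by_cases h : s ∈ A.filter (·.card = j)
        · simp only [dif_pos h]
        · simp only [dif_neg h]
          by_contra hne
          have := f.2 s (Ne.symm hne)
          exact h (mem_filter.2 ⟨(hA s).1 this.1, this.2⟩)
      right_inv := fun g => by
        ext s
        simp only [dif_pos s.2] }
  rw [e.finrank_eq, Module.finrank_fintype_fun_eq_card, Fintype.card_coe]

variable [Fintype V]

theorem bdryMap_apply (f : Finset V → ℝ) (t : Finset V) :
    bdryMap f t = ∑ v ∈ tᶜ, (-1 : ℝ) ^ (t.filter (· < v)).card * f (insert v t) := rfl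

theorem bdryMap_bdryMap (f : Finset V → ℝ) : bdryMap (bdryMap f) = 0 := by
  funext t
  simp only [bdryMap_apply, mul_sum, Pi.zero_apply]
  rw [sum_sigma']
  refine sum_involution (fun x _ => ⟨x.2, x.1⟩) ?_ ?_ ?_ ?_
  · rintro ⟨v, u⟩ h
    simp only [mem_sigma, mem_compl, mem_insert, not_or] at h
    obtain ⟨hv, huv, hu⟩ := h
    simp only
    rw [insert_comm v u, ← mul_assoc, ← mul_assoc, ← add_mul]
    refine mul_eq_zero_of_left ?_ _
    rcases lt_or_gt_of_ne huv with h | h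
    · rw [bdry_sign_swap hu h, neg_add_cancel]
    · rw [bdry_sign_swap hv h, add_neg_cancel]
  · rintro ⟨v, u⟩ h _ heq
    simp only [mem_sigma, mem_compl, mem_insert, not_or] at h
    exact h.2.1 (congrArg Sigma.fst heq)
  · rintro ⟨v, u⟩ h
    simp only [mem_sigma, mem_compl, mem_insert, not_or] at h ⊢
    exact ⟨h.2.2, Ne.symm h.2.1, h.1⟩
  · intro _ _; rfl

variable (K : PreAbstractSimplicialComplex V)

theorem boundaries_le_cycles (j : ℕ) : boundaries K j ≤ cycles K j := by
  rintro _ ⟨f, hf, rfl⟩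
  refine ⟨fun t ht => ?_, LinearMap.mem_ker.2 (bdryMap_bdryMap f)⟩
  rw [bdryMap_apply] at ht
  obtain ⟨v, hv, hne⟩ := exists_ne_zero_of_sum_ne_zero ht
  have hv' : v ∉ t := mem_compl.1 hv
  obtain ⟨h1, h2⟩ := hf _ (right_ne_zero_of_mul hne)
  refine ⟨?_, by rw [card_insert_of_notMem hv'] at h2; omega⟩
  rcases t.eq_empty_or_nonempty with rfl | htn
  · exact Or.inl rfl
  · rcases h1 with h1 | h1
    · exact absurd h1 (insert_ne_empty v t)
    · exact Or.inr ((K.isRelLowerSet_faces h1).2 (subset_insert v t) htn)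

variable {K} {A : Finset (Finset V)}

theorem finrank_map_add_cycles (j : ℕ) :
    Module.finrank ℝ ((chains K j).map bdryMap) + Module.finrank ℝ (cycles K j)
      = Module.finrank ℝ (chains K j) := by
  have h := LinearMap.finrank_range_add_finrank_ker (bdryMap.domRestrict (chains K j))
  rw [LinearMap.range_domRestrict, LinearMap.ker_domRestrict] at h
  rw [← h]
  congr 1
  rw [← Submodule.finrank_map_subtype_eq, Submodule.map_comap_subtype]
  rfl

theorem finrank_redHomology (j : ℕ) :
    Module.finrank ℝ (RedHomology K j) + Module.finrank ℝ (boundaries K j)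
      = Module.finrank ℝ (cycles K j) := by
  rw [← Submodule.finrank_quotient_add_finrank ((boundaries K j).submoduleOf (cycles K j)),
    (Submodule.submoduleOfEquivOfLe (boundaries_le_cycles K j)).finrank_eq]

theorem map_chains_zero : (chains K 0).map bdryMap = ⊥ := by
  rw [eq_bot_iff]
  rintro _ ⟨f, hf, rfl⟩
  rw [Submodule.mem_bot]
  funext t
  rw [bdryMap_apply]
  refine sum_eq_zero fun v _ => ?_
  have : f (insert v t) = 0 := by
    by_contra hne
    exact insert_ne_empty v t (card_eq_zero.1 (hf _ hne).2)
  rw [this, mul_zero]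

/-- Rank-nullity makes the alternating sum telescope; truncation leaves the boundaries in the last
degree as an error term. -/
theorem euler_poincare (hA : ∀ s, s ∈ allFaces K ↔ s ∈ A) (m : ℕ) :
    ∑ j ∈ range (m + 1), (-1 : ℤ) ^ j * (A.filter (·.card = j)).card
      = ∑ j ∈ range (m + 1), (-1 : ℤ) ^ j * Module.finrank ℝ (RedHomology K j)
        + (-1) ^ m * Module.finrank ℝ (boundaries K m) := by
  induction m with
  | zero =>
    have h1 := finrank_map_add_cycles (K := K) 0
    have h2 := finrank_redHomology (K := K) 0
    rw [map_chains_zero, finrank_bot, finrank_chains hA] at h1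
    simp only [zero_add, range_one, sum_singleton, pow_zero, one_mul]
    exact_mod_cast by omega
  | succ m ih =>
    rw [sum_range_succ, ih, sum_range_succ _ (m + 1)]
    have h1 := finrank_map_add_cycles (K := K) (m + 1)
    have h2 := finrank_redHomology (K := K) (m + 1)
    rw [finrank_chains hA] at h1
    have h3 : ((A.filter (·.card = m + 1)).card : ℤ) = Module.finrank ℝ (boundaries K m)
        + (Module.finrank ℝ (RedHomology K (m + 1)) + Module.finrank ℝ (boundaries K (m + 1))) := by
      rw [← h1, ← h2]; push_cast; rfl
    rw [h3]
    ring

theorem boundaries_eq_bot {j : ℕ} (hj : Fintype.card V ≤ j) : boundaries K j = ⊥ := by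
  rw [eq_bot_iff]
  rintro _ ⟨f, hf, rfl⟩
  have : f = 0 := by
    funext s
    by_contra hne
    have h1 := (hf s hne).2
    have h2 := card_le_univ s
    omega
  rw [this, map_zero]
  exact Submodule.zero_mem _

/-- The reduced Euler characteristic of a complex with the homology of a sphere. -/
theorem sum_neg_one_pow_card_eq {d : ℕ} (hA : ∀ s, s ∈ allFaces K ↔ s ∈ A)
    (h1 : Nonempty (RedHomology K d ≃ₗ[ℝ] ℝ))
    (h0 : ∀ j, j ≠ d → Subsingleton (RedHomology K j)) :
    ∑ x ∈ A, (-1 : ℤ) ^ x.card = (-1) ^ d := by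
  -- At this cutoff the error term vanishes, since no simplex has more vertices than `V`, and the
  -- degree `d` lies in the range.
  have h := euler_poincare hA (Fintype.card V + d)
  rw [boundaries_eq_bot (by omega), finrank_bot, Nat.cast_zero, mul_zero, add_zero,
    sum_eq_single (f := fun j => (-1 : ℤ) ^ j * Module.finrank ℝ (RedHomology K j)) d] at h
  · obtain ⟨e⟩ := h1
    rw [e.finrank_eq, Module.finrank_self, Nat.cast_one, mul_one] at h
    rw [← h, ← sum_fiberwise_of_maps_to (t := range (Fintype.card V + d + 1)) (g := card)]
    · refine sum_congr rfl fun j _ => ?_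
      rw [sum_congr rfl (g := fun _ => (-1 : ℤ) ^ j) fun x hx => by rw [(mem_filter.1 hx).2],
        sum_const, nsmul_eq_mul, mul_comm]
    · intro x _
      have := card_le_univ x
      exact mem_range.2 (by omega)
  · intro j _ hj
    have := h0 j hj
    rw [Module.finrank_zero_of_subsingleton, Nat.cast_zero, mul_zero]
  · intro hd
    exact absurd (mem_range.2 (by omega)) hd

/-- Removing `s` identifies the faces containing `s` with all faces of its link, at the cost of the
sign `(-1) ^ s.card`; the link has the Euler characteristic of a sphere. -/
theorem IsGorenstein.euler {n : ℕ} (hK : IsGorenstein n K) (hA : ∀ s, s ∈ allFaces K ↔ s ∈ A)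
    {s : Finset V} (hs : s ∈ A) :
    ∑ x ∈ A with s ⊆ x, (-1 : ℤ) ^ x.card = (-1) ^ (n + 1) := by
  have hle : s.card ≤ n + 1 := by
    rcases (hA s).2 hs with rfl | h
    · simp
    · exact hK.dim_le s h
  have hlink : ∀ y, y ∈ allFaces (link K s) ↔ y ∈ (A.filter (s ⊆ ·)).image (· \ s) := by
    intro y
    have : y ∈ allFaces (link K s) ↔ Disjoint y s ∧ y ∪ s ∈ A := by
      rw [← hA]
      constructor
      · rintro (rfl | ⟨-, hd, hys⟩)
        · exact ⟨disjoint_empty_left s, by rw [empty_union]; exact (hA s).2 hs⟩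
        · exact ⟨hd, Or.inr hys⟩
      · rintro ⟨hd, hys⟩
        rcases y.eq_empty_or_nonempty with rfl | hy
        · exact Or.inl rfl
        · refine Or.inr ⟨hy, hd, hys.resolve_left ?_⟩
          exact (hy.mono subset_union_left).ne_empty
    rw [this]
    simp only [mem_image, mem_filter]
    constructor
    · rintro ⟨hd, hys⟩
      exact ⟨y ∪ s, ⟨hys, subset_union_right⟩, union_sdiff_cancel_right hd⟩
    · rintro ⟨x, ⟨hx, hsx⟩, rfl⟩
      exact ⟨sdiff_disjoint, by rwa [sdiff_union_of_subset hsx]⟩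
  have h := sum_neg_one_pow_card_eq (d := n + 1 - s.card) hlink
    ((hK.homology s ((hA s).2 hs) _).1 (by omega))
    (fun j hj => (hK.homology s ((hA s).2 hs) j).2 (by omega))
  rw [sum_image] at h
  · rw [show n + 1 = (n + 1 - s.card) + s.card by omega, pow_add, ← h, sum_mul]
    refine sum_congr rfl fun x hx => ?_
    rw [← pow_add, card_sdiff_add_card_eq_card (mem_filter.1 hx).2]
  · intro x hx x' hx' heq
    rw [← sdiff_union_of_subset (mem_filter.1 hx).2, ← sdiff_union_of_subset (mem_filter.1 hx').2]
    exact congrArg (· ∪ s) heq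

end

/-! ### Face sums over Boolean intervals. -/

section

variable {V : Type u}

theorem facePsi_succ {m : ℕ} {A : Finset (Finset V)} (h : ∀ s ∈ A, s.card ≤ m) :
    facePsi (m + 1) A = facePsi m A * varE := by
  unfold facePsi
  rw [sum_mul]
  exact sum_congr rfl fun s hs => faceTerm_succ (h s hs)

variable [DecidableEq V]

theorem facePsi_Ico (m : ℕ) {s t : Finset V} (h : s ⊆ t) :
    facePsi m (Ico s t) = properSum (t \ s).card fun i => faceTerm m (i + s.card) := by
  have hd : ∀ y ∈ (t \ s).ssubsets, Disjoint s y := fun y hy =>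
    disjoint_of_subset_right (mem_ssubsets.1 hy).subset disjoint_sdiff
  unfold facePsi
  rw [Ico_eq_image_ssubsets h, sum_image, ← sum_ssubsets_card]
  · refine sum_congr rfl fun y hy => ?_
    rw [card_union_of_disjoint (hd y hy), add_comm]
  · intro y hy y' hy' heq
    rw [← union_sdiff_cancel_left (hd y hy), ← union_sdiff_cancel_left (hd y' hy')]
    exact congrArg (· \ s) heq

theorem facePsi_union (m : ℕ) {A B : Finset (Finset V)} (h : Disjoint A B) :
    facePsi m (A ∪ B) = facePsi m A + facePsi m B := sum_union h

theorem card_add_card_sdiff {R F : Finset V} (h : R ⊆ F) : R.card + (F \ R).card = F.card := by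
  rw [add_comm, card_sdiff_add_card_eq_card h]

theorem facePsi_Ico_sdiff {R F : Finset V} (h : R ⊆ F) :
    facePsi (F.card - 1) (Ico (F \ R) F) = intPsi R.card (F \ R).card := by
  rw [facePsi_Ico _ sdiff_subset, Finset.sdiff_sdiff_eq_self h, intPsi, card_add_card_sdiff h]

theorem facePsi_Ico_self {R F : Finset V} (h : R ⊆ F) :
    facePsi (F.card - 1) (Ico R F) = intPsi (F \ R).card R.card := by
  rw [facePsi_Ico _ h, intPsi, add_comm _ R.card, card_add_card_sdiff h]

theorem facePsi_Icc {n : ℕ} {R F : Finset V} (h : R ⊆ F) (hF : F.card = n + 1) :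
    facePsi (n + 1) (Icc R F) = intPsi (F \ R).card R.card * varE + boolPsi (n + 1) * varB := by
  have h1 : Icc R F = Ico R F ∪ {F} := by
    rw [union_comm, ← insert_eq, Ico_insert_right h]
  rw [h1, facePsi_union _ (by simp), facePsi_succ, ← facePsi_Ico_self h, hF, Nat.add_sub_cancel]
  · congr 1
    rw [facePsi, sum_singleton, hF, faceTerm_self (by omega)]
  · intro s hs
    have := card_lt_card (mem_Ico.1 hs).2
    omega

/-- The faces in question form the Boolean interval from `R ∪ s` to `F`, whose signed count vanishes
unless it is a single point. -/
theorem sum_Icc_filter {R F : Finset V} (hR : R ⊆ F) (s : Finset V) :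
    ∑ x ∈ Icc R F with s ⊆ x, (-1 : ℤ) ^ x.card
      = if s ⊆ F ∧ F \ R ⊆ s then (-1) ^ F.card else 0 := by
  by_cases hs : s ⊆ F
  · have h1 : (Icc R F).filter (s ⊆ ·) = Icc (R ∪ s) F := by
      ext x
      simp only [mem_filter, mem_Icc, union_subset_iff]
      tauto
    rw [h1, sum_neg_one_pow_card_Icc (union_subset hR hs)]
    have h2 : R ∪ s = F ↔ F \ R ⊆ s := by
      rw [show F \ R ⊆ s ↔ F ⊆ R ∪ s from sdiff_le_iff]
      exact ⟨fun h => h.ge, fun h => (union_subset hR hs).antisymm h⟩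
    simp only [h2, hs, true_and]
  · rw [if_neg fun h => hs h.1]
    refine sum_eq_zero fun x hx => ?_
    rw [mem_filter, mem_Icc] at hx
    exact absurd (hx.2.trans hx.1.2) hs

/-! ### Unions of facets of the boundary of a simplex -/

/-- The faces of the union of the facets `F \ {v}`, `v ∈ R`, of the boundary of the simplex `F`. -/
def partialBoundary (R F : Finset V) : Finset (Finset V) := F.powerset.filter fun s => ¬ R ⊆ s

/-- The boundary faces of `partialBoundary R F`. -/
def partialBoundaryRim (R F : Finset V) : Finset (Finset V) :=
  F.powerset.filter fun s => ¬ R ⊆ s ∧ ¬ F \ R ⊆ s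

theorem mem_partialBoundary {R F s : Finset V} :
    s ∈ partialBoundary R F ↔ s ⊆ F ∧ ¬ R ⊆ s := by simp [partialBoundary]

theorem mem_partialBoundaryRim {R F s : Finset V} :
    s ∈ partialBoundaryRim R F ↔ s ⊆ F ∧ ¬ R ⊆ s ∧ ¬ F \ R ⊆ s := by simp [partialBoundaryRim]

theorem eq_of_subset_of_sdiff_subset {R F s : Finset V} (hs : s ⊆ F) (h1 : R ⊆ s)
    (h2 : F \ R ⊆ s) : s = F :=
  hs.antisymm fun v hv => by
    by_cases hvR : v ∈ R
    · exact h1 hvR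
    · exact h2 (mem_sdiff.2 ⟨hv, hvR⟩)

theorem partialBoundary_eq {R F : Finset V} (hR : R ⊆ F) :
    partialBoundary R F = partialBoundaryRim R F ∪ Ico (F \ R) F := by
  ext s
  simp only [mem_partialBoundary, mem_union, mem_partialBoundaryRim, mem_Ico]
  constructor
  · rintro ⟨h1, h2⟩
    by_cases h3 : F \ R ⊆ s
    · exact Or.inr ⟨h3, h1.ssubset_of_ne fun h => h2 (h ▸ hR)⟩
    · exact Or.inl ⟨h1, h2, h3⟩
  · rintro (⟨h1, h2, -⟩ | ⟨h1, h2⟩)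
    · exact ⟨h1, h2⟩
    · exact ⟨h2.subset, fun h => h2.ne (eq_of_subset_of_sdiff_subset h2.subset h h1)⟩

theorem disjoint_rim (R F : Finset V) : Disjoint (partialBoundaryRim R F) (Ico (F \ R) F) := by
  rw [disjoint_left]
  intro s h1 h2
  exact (mem_partialBoundaryRim.1 h1).2.2 (mem_Ico.1 h2).1

/-- A face of the rim splits uniquely into a proper subset of `R` and a proper subset of `F \ R`:
the rim is the join of two simplex boundaries. -/
theorem facePsi_partialBoundaryRim {R F : Finset V} (hR : R ⊆ F) :
    facePsi (F.card - 2) (partialBoundaryRim R F) = joinPsi R.card (F \ R).card := by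
  unfold joinPsi
  rw [← sum_ssubsets_card, card_add_card_sdiff hR]
  simp only [← sum_ssubsets_card]
  rw [← sum_product', facePsi]
  refine sum_bij' (fun s _ => (s ∩ R, s \ R)) (fun x _ => x.1 ∪ x.2) ?_ ?_ ?_ ?_ ?_
  · intro s hs
    rw [mem_partialBoundaryRim] at hs
    rw [mem_product, mem_ssubsets, mem_ssubsets]
    refine ⟨inter_subset_right.ssubset_of_ne fun h => hs.2.1 (inter_eq_right.1 h),
      (sdiff_subset_sdiff hs.1 Subset.rfl).ssubset_of_ne fun h => hs.2.2 ?_⟩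
    rw [← h]; exact sdiff_subset
  · rintro ⟨A, B⟩ hx
    rw [mem_product, mem_ssubsets, mem_ssubsets] at hx
    obtain ⟨hA, hB⟩ := hx
    rw [mem_partialBoundaryRim]
    refine ⟨union_subset (hA.subset.trans hR) (hB.subset.trans sdiff_subset), fun h => ?_,
      fun h => ?_⟩
    · refine hA.not_subset fun v hv => (mem_union.1 (h hv)).resolve_right fun hvB => ?_
      exact (mem_sdiff.1 (hB.subset hvB)).2 hv
    · refine hB.not_subset fun v hv => (mem_union.1 (h hv)).resolve_left fun hvA => ?_
      exact (mem_sdiff.1 hv).2 (hA.subset hvA)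
  · intro s _
    rw [union_comm]; exact sdiff_union_inter s R
  · rintro ⟨A, B⟩ hx
    rw [mem_product, mem_ssubsets, mem_ssubsets] at hx
    obtain ⟨hA, hB⟩ := hx
    have hBR : Disjoint B R := disjoint_of_subset_left hB.subset sdiff_disjoint
    simp only [Prod.mk.injEq]
    constructor
    · rw [union_inter_distrib_right, inter_eq_left.2 hA.subset, disjoint_iff_inter_eq_empty.1 hBR,
        union_empty]
    · rw [union_sdiff_distrib, sdiff_eq_empty_iff_subset.2 hA.subset, empty_union,
        sdiff_eq_self_of_disjoint hBR]
  · intro s _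
    rw [card_inter_add_card_sdiff]

/-- The Euler relations come from partitioning the Boolean lattice of `F`: into the ball and `[R,
F]`, or into the rim, `[R, F]` and `[F \ R, F)`. -/
theorem partialBoundary_isBall {m : ℕ} {R F : Finset V} (hR : R ⊆ F) (hR0 : R.Nonempty)
    (hR1 : (F \ R).Nonempty) (hF : F.card = m + 2) :
    IsBall m (partialBoundary R F) (partialBoundaryRim R F) where
  empty_mem := mem_partialBoundaryRim.2 ⟨empty_subset _,
    fun h => hR0.ne_empty (subset_empty.1 h), fun h => hR1.ne_empty (subset_empty.1 h)⟩
  subset s hs := by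
    rw [partialBoundary_eq hR]; exact mem_union_left _ hs
  down s hs t hts := by
    rw [mem_partialBoundary] at hs ⊢
    exact ⟨hts.trans hs.1, fun h => hs.2 (h.trans hts)⟩
  down_bdry s hs t hts := by
    rw [mem_partialBoundaryRim] at hs ⊢
    exact ⟨hts.trans hs.1, fun h => hs.2.1 (h.trans hts), fun h => hs.2.2 (h.trans hts)⟩
  pure s hs := by
    rw [mem_partialBoundary] at hs
    obtain ⟨v, hv, hvs⟩ := not_subset.1 hs.2
    refine ⟨F.erase v, mem_partialBoundary.2 ⟨erase_subset _ _, fun h => ?_⟩,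
      subset_erase.2 ⟨hs.1, hvs⟩, ?_⟩
    · exact absurd (h hv) (by simp)
    · rw [card_erase_of_mem (hR hv)]; omega
  card_le s hs := by
    rw [mem_partialBoundary] at hs
    have := card_lt_card (hs.1.ssubset_of_ne fun h => hs.2 (h ▸ hR))
    omega
  pure_bdry s hs := by
    rw [mem_partialBoundaryRim] at hs
    obtain ⟨v, hv, hvs⟩ := not_subset.1 hs.2.1
    obtain ⟨w, hw, hws⟩ := not_subset.1 hs.2.2
    have hwF := mem_sdiff.1 hw
    have hvw : v ≠ w := fun h => hwF.2 (h ▸ hv)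
    refine ⟨(F.erase v).erase w, mem_partialBoundaryRim.2 ⟨(erase_subset _ _).trans
      (erase_subset _ _), fun h => ?_, fun h => ?_⟩, subset_erase.2 ⟨subset_erase.2 ⟨hs.1, hvs⟩, hws⟩,
      ?_⟩
    · exact absurd (h hv) (by simp)
    · exact absurd (h hw) (by simp)
    · rw [card_erase_of_mem (mem_erase.2 ⟨hvw.symm, hwF.1⟩), card_erase_of_mem (hR hv)]; omega
  card_bdry_le s hs := by
    rw [mem_partialBoundaryRim] at hs
    obtain ⟨v, hv, hvs⟩ := not_subset.1 hs.2.1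
    obtain ⟨w, hw, hws⟩ := not_subset.1 hs.2.2
    have hwF := mem_sdiff.1 hw
    have hvw : v ≠ w := fun h => hwF.2 (h ▸ hv)
    have h1 := card_le_card (subset_erase.2 ⟨subset_erase.2 ⟨hs.1, hvs⟩, hws⟩)
    rw [card_erase_of_mem (mem_erase.2 ⟨hvw.symm, hwF.1⟩), card_erase_of_mem (hR hv)] at h1
    omega
  euler s hs := by
    rw [mem_partialBoundary] at hs
    have h1 : (Icc ∅ F).filter (s ⊆ ·)
        = (partialBoundary R F).filter (s ⊆ ·) ∪ (Icc R F).filter (s ⊆ ·) := by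
      ext x
      simp only [mem_union, mem_filter, mem_partialBoundary, mem_Icc]
      have := empty_subset x
      tauto
    have h2 := sum_Icc_filter (empty_subset F) s
    rw [if_neg fun h => hs.2 (hR.trans (by simpa using h.2)), h1, sum_union, sum_Icc_filter hR] at h2
    · rw [eq_neg_of_add_eq_zero_left h2, hF]
      simp only [mem_partialBoundaryRim, hs.1, hs.2, not_false_eq_true, true_and]
      split_ifs <;> first | contradiction | ring
    · rw [disjoint_left]
      intro x hx hx'
      exact (mem_partialBoundary.1 (mem_filter.1 hx).1).2 (mem_Icc.1 (mem_filter.1 hx').1).1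
  euler_bdry s hs := by
    rw [mem_partialBoundaryRim] at hs
    have h1 : (Icc ∅ F).filter (s ⊆ ·)
        = ((partialBoundaryRim R F).filter (s ⊆ ·) ∪ (Icc R F).filter (s ⊆ ·)) ∪
          ((Icc (F \ R) F).filter (s ⊆ ·)).erase F := by
      ext x
      simp only [mem_union, mem_filter, mem_partialBoundaryRim, mem_Icc, mem_erase]
      have h0 := empty_subset x
      constructor
      · rintro ⟨⟨-, hx⟩, hsx⟩
        by_cases h3 : R ⊆ x
        · exact Or.inl (Or.inr ⟨⟨h3, hx⟩, hsx⟩)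
        · by_cases h4 : F \ R ⊆ x
          · exact Or.inr ⟨fun h => h3 (h ▸ hR), ⟨h4, hx⟩, hsx⟩
          · exact Or.inl (Or.inl ⟨⟨hx, h3, h4⟩, hsx⟩)
      · rintro ((⟨⟨hx, -⟩, hsx⟩ | ⟨⟨-, hx⟩, hsx⟩) | ⟨-, ⟨-, hx⟩, hsx⟩) <;> exact ⟨⟨h0, hx⟩, hsx⟩
    have hd1 : Disjoint ((partialBoundaryRim R F).filter (s ⊆ ·)) ((Icc R F).filter (s ⊆ ·)) := by
      rw [disjoint_left]
      intro x hx hx'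
      exact (mem_partialBoundaryRim.1 (mem_filter.1 hx).1).2.1 (mem_Icc.1 (mem_filter.1 hx').1).1
    have hd2 : Disjoint ((partialBoundaryRim R F).filter (s ⊆ ·) ∪ (Icc R F).filter (s ⊆ ·))
        (((Icc (F \ R) F).filter (s ⊆ ·)).erase F) := by
      rw [disjoint_left]
      intro x hx hx'
      simp only [mem_union, mem_filter, mem_partialBoundaryRim, mem_Icc, mem_erase] at hx hx'
      rcases hx with ⟨⟨-, -, h⟩, -⟩ | ⟨⟨h, h'⟩, -⟩
      · exact h hx'.2.1.1
      · exact hx'.1 (eq_of_subset_of_sdiff_subset h' h hx'.2.1.1)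
    have hFm : F ∈ (Icc (F \ R) F).filter (s ⊆ ·) :=
      mem_filter.2 ⟨mem_Icc.2 ⟨sdiff_subset, le_rfl⟩, hs.1⟩
    have h3 := sum_Icc_filter (empty_subset F) s
    have h4 := sum_Icc_filter (sdiff_subset : F \ R ⊆ F) s
    rw [← add_sum_erase _ _ hFm, Finset.sdiff_sdiff_eq_self hR, if_neg fun h => hs.2.1 h.2] at h4
    rw [if_neg fun h => hs.2.1 (hR.trans (by simpa using h.2)), h1, sum_union hd2, sum_union hd1,
      sum_Icc_filter hR, if_neg fun h => hs.2.2 h.2] at h3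
    rw [hF, pow_add] at h4
    linarith

theorem ballLoc_partialBoundary {m : ℕ} {R F : Finset V} (hR : R ⊆ F) (hR0 : R.Nonempty)
    (hR1 : (F \ R).Nonempty) (hF : F.card = m + 2) :
    ballLoc m (partialBoundary R F) (partialBoundaryRim R F) = locPsi R.card (F \ R).card := by
  have h1 := facePsi_partialBoundaryRim hR
  have h2 := facePsi_Ico_sdiff hR
  rw [hF] at h1 h2
  rw [ballLoc, partialBoundary_eq hR, facePsi_union _ (disjoint_rim R F),
    facePsi_succ (partialBoundary_isBall hR hR0 hR1 hF).card_bdry_le]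
  rw [Nat.add_sub_cancel] at h1
  rw [h1, show m + 1 = m + 2 - 1 by omega, h2, locPsi, varE]
  noncomm_ring

end

/-! ### Shellings of spheres through restriction faces. -/

section

variable {V : Type u}

/-- `F_l` is the last facet containing `s`. -/
def IsLast (F : ℕ → Finset V) (k : ℕ) (s : Finset V) (l : ℕ) : Prop :=
  l < k ∧ s ⊆ F l ∧ ∀ m, l < m → m < k → ¬ s ⊆ F m

theorem IsLast.unique {F : ℕ → Finset V} {k : ℕ} {s : Finset V} {l m : ℕ} (hl : IsLast F k s l) (hm : IsLast F k s m) :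
    l = m := by
  rcases lt_trichotomy l m with h | h | h
  · exact absurd hm.2.1 (hl.2.2 m h hm.1)
  · exact h
  · exact absurd hl.2.1 (hm.2.2 l h hl.1)

variable [DecidableEq V]

/-- The faces of `F_0 ∪ ⋯ ∪ F_{j-1}`. -/
def facesBelow (F : ℕ → Finset V) (j : ℕ) : Finset (Finset V) :=
  (range j).biUnion fun l => (F l).powerset

/-- The faces that `F_0 ∪ ⋯ ∪ F_{j-1}` shares with `F_j ∪ ⋯ ∪ F_{k-1}`. -/
def facesBdry (F : ℕ → Finset V) (k j : ℕ) : Finset (Finset V) :=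
  (facesBelow F j).filter fun s => ∃ m ∈ Ico j k, s ⊆ F m

theorem mem_facesBelow {F : ℕ → Finset V} {j : ℕ} {s : Finset V} :
    s ∈ facesBelow F j ↔ ∃ l < j, s ⊆ F l := by simp [facesBelow]

theorem mem_facesBdry {F : ℕ → Finset V} {k j : ℕ} {s : Finset V} :
    s ∈ facesBdry F k j ↔ (∃ l < j, s ⊆ F l) ∧ ∃ m, j ≤ m ∧ m < k ∧ s ⊆ F m := by
  simp [facesBdry, mem_facesBelow, and_assoc]

/-- A shelling `F_0, …, F_{k-1}` with restriction faces `R_j` of an `n`-dimensional complex with the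
Euler characteristics of a sphere. -/
structure IsSphereShelling (n k : ℕ) (F R : ℕ → Finset V) : Prop where
  card : ∀ j < k, (F j).card = n + 1
  sub : ∀ j < k, R j ⊆ F j
  covered : ∀ j < k, ∀ s ⊆ F j, (∃ l < j, s ⊆ F l) ↔ ¬ R j ⊆ s
  euler : ∀ s ∈ facesBelow F k, ∑ x ∈ facesBelow F k with s ⊆ x, (-1 : ℤ) ^ x.card = (-1) ^ (n + 1)

namespace IsSphereShelling
variable {n k : ℕ} {F R : ℕ → Finset V}

theorem facesBelow_succ (h : IsSphereShelling n k F R) {j : ℕ} (hj : j < k) :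
    facesBelow F (j + 1) = facesBelow F j ∪ Icc (R j) (F j) := by
  ext s
  simp only [mem_facesBelow, mem_union, mem_Icc]
  constructor
  · rintro ⟨l, hl, hs⟩
    by_cases hc : ∃ l < j, s ⊆ F l
    · exact Or.inl hc
    · obtain rfl : l = j := by
        by_contra hne
        exact hc ⟨l, by omega, hs⟩
      exact Or.inr ⟨not_not.1 fun hR => hc ((h.covered l hj s hs).2 hR), hs⟩
  · rintro (⟨l, hl, hs⟩ | ⟨-, hs⟩)
    · exact ⟨l, by omega, hs⟩
    · exact ⟨j, by omega, hs⟩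

theorem disjoint_facesBelow (h : IsSphereShelling n k F R) {j : ℕ} (hj : j < k) :
    Disjoint (facesBelow F j) (Icc (R j) (F j)) := by
  rw [disjoint_left]
  intro s hs hs'
  rw [mem_Icc] at hs'
  exact (h.covered j hj s hs'.2).1 (mem_facesBelow.1 hs) hs'.1

theorem sum_facesBelow (h : IsSphereShelling n k F R) (f : Finset V → ℤ) {j : ℕ} (hj : j ≤ k) :
    ∑ x ∈ facesBelow F j, f x = ∑ l ∈ range j, ∑ x ∈ Icc (R l) (F l), f x := by
  induction j with
  | zero => simp [facesBelow]
  | succ j ih =>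
    rw [h.facesBelow_succ hj, sum_union (h.disjoint_facesBelow hj), ih (by omega), sum_range_succ]

/-- Sum over the shelling intervals `[R l, F l]`: each contributes only when `R l ∪ s = F l`. -/
theorem euler_facesBelow (h : IsSphereShelling n k F R) (s : Finset V) {j : ℕ} (hj : j ≤ k) :
    ∑ x ∈ facesBelow F j with s ⊆ x, (-1 : ℤ) ^ x.card
      = ((range j).filter fun l => s ⊆ F l ∧ F l \ R l ⊆ s).card * (-1) ^ (n + 1) := by
  rw [sum_filter, h.sum_facesBelow _ hj, card_filter, Nat.cast_sum, sum_mul]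
  refine sum_congr rfl fun l hl => ?_
  have hlk : l < k := (mem_range.1 hl).trans_le hj
  rw [← sum_filter, sum_Icc_filter (h.sub l hlk), h.card l hlk]
  split_ifs <;> simp

theorem card_first (h : IsSphereShelling n k F R) {s : Finset V} {j : ℕ} (hj : j ≤ k)
    (hs : s ∈ facesBelow F j) : ((range j).filter fun l => s ⊆ F l ∧ R l ⊆ s).card = 1 := by
  have h1 := h.sum_facesBelow (fun x => if x = s then 1 else 0) hj
  rw [sum_ite_eq', if_pos hs] at h1
  rw [card_filter, ← Nat.cast_inj (R := ℤ), Nat.cast_sum, Nat.cast_one, h1]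
  refine sum_congr rfl fun l _ => ?_
  rw [sum_ite_eq']
  simp [mem_Icc, and_comm]

theorem exists_isLast {s : Finset V} {l : ℕ} (hl : l < k) (hs : s ⊆ F l) :
    ∃ m, l ≤ m ∧ IsLast F k s m := by
  obtain ⟨m, hm, hmax⟩ := exists_max_image ((range k).filter fun m => s ⊆ F m) id
    ⟨l, mem_filter.2 ⟨mem_range.2 hl, hs⟩⟩
  rw [mem_filter, mem_range] at hm
  refine ⟨m, hmax l (mem_filter.2 ⟨mem_range.2 hl, hs⟩), hm.1, hm.2, fun i hi hik his => ?_⟩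
  have := hmax i (mem_filter.2 ⟨mem_range.2 hik, his⟩)
  simp only [id] at this
  omega

/-- The left side counts opposite intervals containing `s`. Up to a common sign it is the
alternating sum over the faces above `s`, which the sphere relation evaluates. Thus the opposite
intervals partition the faces. -/
theorem card_opposite (h : IsSphereShelling n k F R) {s : Finset V} (hs : s ∈ facesBelow F k) :
    ((range k).filter fun l => s ⊆ F l ∧ F l \ R l ⊆ s).card = 1 := by
  have h1 := h.euler s hs
  rw [h.euler_facesBelow s le_rfl] at h1
  have h2 := mul_right_cancel₀ (pow_ne_zero (n + 1) (by norm_num : (-1 : ℤ) ≠ 0))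
    (h1.trans (one_mul _).symm)
  exact_mod_cast h2

/-- The ridge `F m \ {v}` lies in a unique opposite interval, belonging to some `l`. It is not that
of `m`, as `v` is missing from the ridge; and no earlier facet contains the ridge, as it contains `R
m`. -/
theorem exists_later (h : IsSphereShelling n k F R) {m : ℕ} (hm : m < k) {v : V} (hv : v ∈ F m)
    (hvR : v ∉ R m) : ∃ m', m < m' ∧ m' < k ∧ (F m).erase v ⊆ F m' := by
  have hz : (F m).erase v ∈ facesBelow F k := mem_facesBelow.2 ⟨m, hm, erase_subset _ _⟩
  obtain ⟨l, hl⟩ := card_eq_one.1 (h.card_opposite hz)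
  have hlm : l ∈ ({l} : Finset ℕ) := mem_singleton_self l
  rw [← hl, mem_filter, mem_range] at hlm
  obtain ⟨hlk, hzl, hop⟩ := hlm
  have hne : l ≠ m := by
    rintro rfl
    exact absurd (hop (mem_sdiff.2 ⟨hv, hvR⟩)) (by simp)
  refine ⟨l, lt_of_le_of_ne (le_of_not_gt fun hlt => ?_) hne.symm, hlk, hzl⟩
  exact (h.covered m hm _ (erase_subset _ _)).1 ⟨l, hlt, hzl⟩
    (subset_erase.2 ⟨h.sub m hm, hvR⟩)

/-- The last facet containing `s` is the one whose interval in the reversed shelling contains `s`. -/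
theorem isLast_iff (h : IsSphereShelling n k F R) {s : Finset V} {l : ℕ} (hl : l < k)
    (hs : s ⊆ F l) : F l \ R l ⊆ s ↔ IsLast F k s l := by
  -- A vertex of `F m \ R m` missing from `s` would put `s` into a ridge shared with a later facet.
  -- The converse follows from uniqueness of the opposite interval.
  have hlast : ∀ m, IsLast F k s m → F m \ R m ⊆ s := by
    rintro m ⟨hm, hsm, hmax⟩ v hv
    by_contra hvs
    rw [mem_sdiff] at hv
    obtain ⟨m', h1, h2, h3⟩ := h.exists_later hm hv.1 hv.2
    exact hmax m' h1 h2 ((subset_erase.2 ⟨hsm, hvs⟩).trans h3)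
  refine ⟨fun hop => ?_, hlast l⟩
  obtain ⟨m, -, hm⟩ := exists_isLast hl hs
  have h1 := card_le_one.1 (h.card_opposite (mem_facesBelow.2 ⟨l, hl, hs⟩)).le l
    (mem_filter.2 ⟨mem_range.2 hl, hs, hop⟩) m
    (mem_filter.2 ⟨mem_range.2 hm.1, hm.2.1, hlast m hm⟩)
  exact h1 ▸ hm

theorem not_subset_of_lt (h : IsSphereShelling n k F R) {l m : ℕ} (hlm : l < m) (hm : m < k) :
    ¬ F m ⊆ F l := fun hs =>
  (h.covered m hm (F m) Subset.rfl).1 ⟨l, hlm, hs⟩ (h.sub m hm)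

theorem not_subset_of_ne (h : IsSphereShelling n k F R) {l m : ℕ} (hlm : l ≠ m) (hl : l < k)
    (hm : m < k) : ¬ F m ⊆ F l := fun hs => by
  rcases lt_or_gt_of_ne hlm with hlt | hlt
  · exact h.not_subset_of_lt hlt hm hs
  · have : F m = F l := eq_of_subset_of_card_le hs (by rw [h.card l hl, h.card m hm])
    exact h.not_subset_of_lt hlt hl this.ge

theorem facesBelow_filter_interior (h : IsSphereShelling n k F R) {j : ℕ} (hj : j ≤ k)
    (s : Finset V) :
    ((facesBelow F j).filter (s ⊆ ·)).filter (· ∉ facesBdry F k j)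
      = (range j).biUnion fun l => (Icc (F l \ R l) (F l)).filter (s ⊆ ·) := by
  ext x
  simp only [mem_filter, mem_facesBelow, mem_facesBdry, mem_biUnion, mem_range, mem_Icc]
  constructor
  · rintro ⟨⟨⟨l, hl, hx⟩, hsx⟩, hn⟩
    obtain ⟨m, -, hm⟩ := exists_isLast (hl.trans_le hj) hx
    refine ⟨m, ?_, ⟨(h.isLast_iff hm.1 hm.2.1).2 hm, hm.2.1⟩, hsx⟩
    by_contra hmj
    exact hn ⟨⟨l, hl, hx⟩, m, not_lt.1 hmj, hm.1, hm.2.1⟩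
  · rintro ⟨l, hl, ⟨hop, hx⟩, hsx⟩
    have hlast := (h.isLast_iff (hl.trans_le hj) hx).1 hop
    refine ⟨⟨⟨l, hl, hx⟩, hsx⟩, ?_⟩
    rintro ⟨-, m, hjm, hmk, hxm⟩
    exact hlast.2.2 m (by omega) hmk hxm

/-- Interior faces are those whose last facet has index below `j`. Counting opposite intervals gives
the ball relation, and subtracting the interior contribution gives the sphere relation of the
boundary. -/
theorem isBall (h : IsSphereShelling n k F R) {j : ℕ} (hj1 : 1 ≤ j) (hjk : j < k) :
    IsBall n (facesBelow F j) (facesBdry F k j) where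
  empty_mem := mem_facesBdry.2 ⟨⟨0, hj1, empty_subset _⟩, j, le_rfl, hjk, empty_subset _⟩
  subset := filter_subset _ _
  down s hs t hts := by
    rw [mem_facesBelow] at hs ⊢
    obtain ⟨l, hl, hs⟩ := hs
    exact ⟨l, hl, hts.trans hs⟩
  down_bdry s hs t hts := by
    rw [mem_facesBdry] at hs ⊢
    obtain ⟨⟨l, hl, hs⟩, m, h1, h2, hs'⟩ := hs
    exact ⟨⟨l, hl, hts.trans hs⟩, m, h1, h2, hts.trans hs'⟩
  pure s hs := by
    rw [mem_facesBelow] at hs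
    obtain ⟨l, hl, hs⟩ := hs
    exact ⟨F l, mem_facesBelow.2 ⟨l, hl, Subset.rfl⟩, hs, h.card l (hl.trans hjk)⟩
  card_le s hs := by
    rw [mem_facesBelow] at hs
    obtain ⟨l, hl, hs⟩ := hs
    exact (card_le_card hs).trans (h.card l (hl.trans hjk)).le
  pure_bdry s hs := by
    classical
    rw [mem_facesBdry] at hs
    obtain ⟨⟨l, hl, hsl⟩, hex⟩ := hs
    -- Choose the first facet `F m` with `m ≥ j` containing `s`. Dropping a vertex of `R m` outside
    -- `s` gives a ridge in an earlier facet, whose index is below `j` by minimality of `m`.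
    obtain ⟨hjm, hmk, hsm⟩ := Nat.find_spec hex
    have hmin := fun i hi => Nat.find_min hex (m := i) hi
    generalize Nat.find hex = m at *
    obtain ⟨v, hv, hvs⟩ := not_subset.1 ((h.covered m hmk s hsm).1 ⟨l, by omega, hsl⟩)
    obtain ⟨i, him, hzi⟩ := (h.covered m hmk ((F m).erase v) (erase_subset _ _)).2
      fun hc => absurd (hc hv) (by simp)
    have hsz : s ⊆ (F m).erase v := subset_erase.2 ⟨hsm, hvs⟩
    have hij : i < j := by
      by_contra hji
      exact hmin i him ⟨not_lt.1 hji, by omega, hsz.trans hzi⟩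
    refine ⟨(F m).erase v, mem_facesBdry.2 ⟨⟨i, hij, hzi⟩, m, hjm, hmk, erase_subset _ _⟩, hsz, ?_⟩
    rw [card_erase_of_mem (h.sub m hmk hv), h.card m hmk, Nat.add_sub_cancel]
  card_bdry_le s hs := by
    rw [mem_facesBdry] at hs
    obtain ⟨⟨l, hl, hsl⟩, m, h1, h2, hsm⟩ := hs
    have hne : s ≠ F m := fun he => h.not_subset_of_lt (by omega : l < m) h2 (he ▸ hsl)
    have := card_lt_card (hsm.ssubset_of_ne hne)
    rw [h.card m h2] at this
    omega
  euler s hs := by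
    rw [h.euler_facesBelow s hjk.le]
    have hs' := mem_facesBelow.1 hs
    obtain ⟨l, hl, hsl⟩ := hs'
    obtain ⟨m, -, hm⟩ := exists_isLast (hl.trans hjk) hsl
    split_ifs with hD
    · obtain ⟨-, i, h1, h2, h3⟩ := mem_facesBdry.1 hD
      rw [filter_false_of_mem, card_empty, Nat.cast_zero, zero_mul]
      rintro x hx ⟨hx1, hx2⟩
      rw [mem_range] at hx
      exact ((h.isLast_iff (hx.trans hjk) hx1).1 hx2).2.2 i (by omega) h2 h3
    · have : ((range j).filter fun l => s ⊆ F l ∧ F l \ R l ⊆ s) = {m} := by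
        ext x
        rw [mem_filter, mem_range, mem_singleton]
        constructor
        · rintro ⟨hx, hx1, hx2⟩
          exact ((h.isLast_iff (hx.trans hjk) hx1).1 hx2).unique hm
        · rintro rfl
          refine ⟨?_, hm.2.1, (h.isLast_iff hm.1 hm.2.1).2 hm⟩
          by_contra hxj
          exact hD (mem_facesBdry.2 ⟨⟨l, hl, hsl⟩, x, not_lt.1 hxj, hm.1, hm.2.1⟩)
      rw [this, card_singleton, Nat.cast_one, one_mul]
  euler_bdry s hs := by
    have hsK : s ∈ facesBelow F j := filter_subset _ _ hs
    have h1 : ∑ x ∈ facesBelow F j with s ⊆ x, (-1 : ℤ) ^ x.card = 0 := by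
      rw [h.euler_facesBelow s hjk.le, filter_false_of_mem, card_empty, Nat.cast_zero, zero_mul]
      obtain ⟨-, i, h1, h2, h3⟩ := mem_facesBdry.1 hs
      rintro x hx ⟨hx1, hx2⟩
      rw [mem_range] at hx
      exact ((h.isLast_iff (hx.trans hjk) hx1).1 hx2).2.2 i (by omega) h2 h3
    have h2 : ((facesBelow F j).filter (s ⊆ ·)).filter (· ∈ facesBdry F k j)
        = (facesBdry F k j).filter (s ⊆ ·) := by
      ext x
      simp only [mem_filter]
      exact ⟨fun hx => ⟨hx.2, hx.1.2⟩, fun hx => ⟨⟨filter_subset _ _ hx.1, hx.2⟩, hx.1⟩⟩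
    rw [← sum_filter_add_sum_filter_not _ (· ∈ facesBdry F k j), h2,
      h.facesBelow_filter_interior hjk.le, sum_biUnion] at h1
    -- On the opposite intervals the roles of `R l` and `F l \ R l` are exchanged, so the interior
    -- sum counts the original shelling intervals containing `s`, and there is exactly one.
    · have h3 : ∀ l ∈ range j, ∑ x ∈ Icc (F l \ R l) (F l) with s ⊆ x, (-1 : ℤ) ^ x.card
          = (if s ⊆ F l ∧ R l ⊆ s then 1 else 0) * (-1) ^ (n + 1) := fun l hl => by
        have hlk : l < k := (mem_range.1 hl).trans hjk
        rw [sum_Icc_filter sdiff_subset, Finset.sdiff_sdiff_eq_self (h.sub l hlk), h.card l hlk]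
        split_ifs <;> simp
      have h4 := h.card_first hjk.le hsK
      rw [card_filter, ← Nat.cast_inj (R := ℤ), Nat.cast_sum] at h4
      push_cast at h4
      rw [sum_congr rfl h3, ← sum_mul, h4, pow_succ] at h1
      linarith
    · intro l hl m hm hne
      simp only [Function.onFun]
      rw [disjoint_left]
      intro x hx hx'
      simp only [coe_range, Set.mem_Iio] at hl hm
      simp only [mem_filter, mem_Icc] at hx hx'
      exact hne (((h.isLast_iff (hl.trans hjk) hx.1.2).1 hx.1.1).unique
        ((h.isLast_iff (hm.trans hjk) hx'.1.2).1 hx'.1.1))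

/-- Adding a facet flips the boundary: the faces in `[F j \ R j, F j)` become interior, and the new
proper faces in `[R j, F j)` become boundary faces. -/
theorem facesBdry_succ_union (h : IsSphereShelling n k F R) {j : ℕ} (hj : j + 1 < k) :
    facesBdry F k (j + 1) ∪ Ico (F j \ R j) (F j) = facesBdry F k j ∪ Ico (R j) (F j) := by
  have hjk : j < k := by omega
  ext s
  simp only [mem_union, mem_facesBdry, mem_Ico]
  constructor
  · rintro (⟨⟨l, hl, hsl⟩, m, h1, h2, hsm⟩ | ⟨hop, hs⟩)
    · by_cases hc : ∃ l < j, s ⊆ F l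
      · exact Or.inl ⟨hc, m, by omega, h2, hsm⟩
      · obtain rfl : l = j := by
          by_contra hne
          exact hc ⟨l, by omega, hsl⟩
        refine Or.inr ⟨not_not.1 fun hR => hc ((h.covered l hjk s hsl).2 hR),
          hsl.ssubset_of_ne ?_⟩
        rintro rfl
        exact h.not_subset_of_ne (by omega : m ≠ l) h2 hjk hsm
    · refine Or.inl ⟨(h.covered j hjk s hs.subset).2 fun hR => hs.ne ?_, j, le_rfl, hjk, hs.subset⟩
      exact eq_of_subset_of_sdiff_subset hs.subset hR hop
  · rintro (⟨⟨l, hl, hsl⟩, m, h1, h2, hsm⟩ | ⟨hR, hs⟩)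
    · by_cases hc : ∃ m, j + 1 ≤ m ∧ m < k ∧ s ⊆ F m
      · exact Or.inl ⟨⟨l, by omega, hsl⟩, hc⟩
      · obtain rfl : m = j := by
          by_contra hne
          exact hc ⟨m, by omega, h2, hsm⟩
        refine Or.inr ⟨(h.isLast_iff hjk hsm).2 ⟨hjk, hsm, fun i h3 h4 h5 => hc ⟨i, h3, h4, h5⟩⟩,
          hsm.ssubset_of_ne ?_⟩
        rintro rfl
        exact h.not_subset_of_lt hl hjk hsl
    · refine Or.inl ⟨⟨j, by omega, hs.subset⟩, ?_⟩
      by_contra hc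
      refine hs.ne (eq_of_subset_of_sdiff_subset hs.subset hR
        ((h.isLast_iff hjk hs.subset).2 ⟨hjk, hs.subset, fun i h3 h4 h5 => hc ⟨i, h3, h4, h5⟩⟩))

theorem disjoint_facesBdry_succ (h : IsSphereShelling n k F R) {j : ℕ} (hj : j + 1 < k) :
    Disjoint (facesBdry F k (j + 1)) (Ico (F j \ R j) (F j)) := by
  rw [disjoint_left]
  intro s hs hs'
  rw [mem_Ico] at hs'
  obtain ⟨-, m, h1, h2, h3⟩ := mem_facesBdry.1 hs
  exact ((h.isLast_iff (by omega) hs'.2.subset).1 hs'.1).2.2 m (by omega) h2 h3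

theorem disjoint_facesBdry (h : IsSphereShelling n k F R) {j : ℕ} (hj : j < k) :
    Disjoint (facesBdry F k j) (Ico (R j) (F j)) :=
  Disjoint.mono (filter_subset _ _) Ico_subset_Icc_self (h.disjoint_facesBelow hj)

theorem facePsi_facesBdry_succ (h : IsSphereShelling n k F R) {j : ℕ} (hj : j + 1 < k) :
    facePsi n (facesBdry F k (j + 1)) + intPsi (R j).card (F j \ R j).card
      = facePsi n (facesBdry F k j) + intPsi (F j \ R j).card (R j).card := by
  have hjk : j < k := by omega
  have h1 := facePsi_Ico_sdiff (h.sub j hjk)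
  have h2 := facePsi_Ico_self (h.sub j hjk)
  rw [h.card j hjk, Nat.add_sub_cancel] at h1 h2
  rw [← h1, ← h2, ← facePsi_union _ (h.disjoint_facesBdry_succ hj),
    ← facePsi_union _ (h.disjoint_facesBdry hjk), h.facesBdry_succ_union hj]

theorem facePsi_facesBelow_succ (h : IsSphereShelling n k F R) {j : ℕ} (hj : j < k) :
    facePsi (n + 1) (facesBelow F (j + 1)) = facePsi (n + 1) (facesBelow F j)
      + (intPsi (F j \ R j).card (R j).card * varE + boolPsi (n + 1) * varB) := by
  rw [h.facesBelow_succ hj, facePsi_union _ (h.disjoint_facesBelow hj),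
    facePsi_Icc (h.sub j hj) (h.card j hj)]

theorem restriction_nonempty (h : IsSphereShelling n k F R) {j : ℕ} (hj1 : 1 ≤ j) (hj : j < k) :
    (R j).Nonempty := by
  rw [nonempty_iff_ne_empty]
  intro h0
  exact (h.covered j hj ∅ (empty_subset _)).1 ⟨0, hj1, empty_subset _⟩ (h0 ▸ Subset.rfl)

theorem opposite_nonempty (h : IsSphereShelling n k F R) {j : ℕ} (hj : j + 1 < k) :
    (F j \ R j).Nonempty := by
  rw [nonempty_iff_ne_empty]
  intro h0
  have hjk : j < k := by omega
  exact ((h.isLast_iff hjk (empty_subset _)).1 (h0 ▸ Subset.rfl)).2.2 (j + 1) (by omega) hj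
    (empty_subset _)

theorem card_add_card (h : IsSphereShelling n k F R) {j : ℕ} (hj : j < k) :
    (R j).card + (F j \ R j).card = n + 1 := by
  rw [card_add_card_sdiff (h.sub j hj), h.card j hj]

/-- The added interval and the boundary flip are inserted into the definition of the local index;
splitting the index of the simplex by `boolPsi_add` leaves the local index of `Γ` times `c` plus its
boundary index times `d`. -/
theorem ballLoc_succ (h : IsSphereShelling n k F R) {j : ℕ} (hj1 : 1 ≤ j) (hj : j + 1 < k) :
    ballLoc n (facesBelow F (j + 1)) (facesBdry F k (j + 1))
      = ballLoc n (facesBelow F j) (facesBdry F k j)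
        + (locPsi (R j).card (F j \ R j).card * (varA + varB)
          + joinPsi (R j).card (F j \ R j).card * (varA * varB + varB * varA)) := by
  have hjk : j < k := by omega
  have hb := boolPsi_add (h.restriction_nonempty hj1 hjk).card_pos (h.opposite_nonempty hj).card_pos
  rw [h.card_add_card hjk] at hb
  unfold ballLoc locPsi
  rw [h.facePsi_facesBelow_succ hjk, eq_sub_of_add_eq (h.facePsi_facesBdry_succ hj), hb]
  unfold varE
  noncomm_ring

theorem facePsi_facesBdry_succ' (h : IsSphereShelling n k F R) {j : ℕ} (hj : j + 1 < k) :
    facePsi n (facesBdry F k (j + 1)) = facePsi n (facesBdry F k j)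
      + (locPsi (F j \ R j).card (R j).card - locPsi (R j).card (F j \ R j).card) := by
  rw [eq_sub_of_add_eq (h.facePsi_facesBdry_succ hj)]
  unfold locPsi
  rw [joinPsi_symm (F j \ R j).card]
  abel

/-- The cd-polynomials are accumulated along the shelling. A single simplex has local index `0`, and
each further facet changes both indices by `cd`-polynomials. The parameter `j` stands for the first
`j + 1` facets. -/
theorem exists_cd (h : IsSphereShelling n k F R) (j : ℕ) (hj : j + 1 < k) :
    (∃ l, cdToAB l = ballLoc n (facesBelow F (j + 1)) (facesBdry F k (j + 1))) ∧
      ∃ β, cdToAB β = facePsi n (facesBdry F k (j + 1)) := by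
  induction j with
  | zero =>
    have h0 : R 0 = ∅ := by
      have := (h.covered 0 (by omega) ∅ (empty_subset _)).not_left.1 (by simp)
      exact subset_empty.1 this
    have hB : facePsi n (facesBdry F k 1) = boolPsi (n + 1) := by
      have h1 := h.facePsi_facesBdry_succ hj
      rw [h0, sdiff_empty, h.card 0 (by omega)] at h1
      have h2 : facesBdry F k 0 = ∅ := by simp [facesBdry, facesBelow]
      rw [h2] at h1
      simpa [intPsi, properSum_zero, facePsi, boolPsi_eq] using h1
    have hK : facePsi (n + 1) (facesBelow F 1) = boolPsi (n + 1) * varE + boolPsi (n + 1) * varB := by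
      rw [h.facePsi_facesBelow_succ (by omega), h0, sdiff_empty, h.card 0 (by omega)]
      simp [facesBelow, facePsi, intPsi, boolPsi_eq]
    constructor
    · refine ⟨0, ?_⟩
      rw [map_zero, ballLoc, hK, hB, varE]
      noncomm_ring
    -- The boundary of one simplex is the degenerate join with parameters `1` and `n + 1`.
    · obtain ⟨p, hp, -⟩ := isNonnegCD_joinPsi (p := 1) (q := n + 1) le_rfl (by omega)
      exact ⟨p, by rw [hp, joinPsi_one, hB]⟩
  | succ j ih =>
    obtain ⟨⟨l, hl⟩, β, hβ⟩ := ih (by omega)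
    have hp := (h.restriction_nonempty (j := j + 1) (by omega) (by omega)).card_pos
    have hq := (h.opposite_nonempty hj).card_pos
    obtain ⟨x, hx, -⟩ := isNonnegCD_locPsi hp hq
    obtain ⟨y, hy, -⟩ := isNonnegCD_locPsi hq hp
    obtain ⟨z, hz, -⟩ := isNonnegCD_joinPsi hp hq
    refine ⟨⟨l + (x * varC + z * varD), ?_⟩, β + (y - x), ?_⟩
    · rw [h.ballLoc_succ (by omega) hj, ← hl, ← hx, ← hz]
      simp
    · rw [h.facePsi_facesBdry_succ' hj, ← hβ, ← hx, ← hy]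
      simp

end IsSphereShelling

end

/-! ### Restriction faces from the recursive definition of a shelling. -/

section

variable {V : Type u}

theorem IsShelling.isFacetOrder {n : ℕ} {K : PreAbstractSimplicialComplex V} {L : List (Finset V)}
    (h : IsShelling n K L) : IsFacetOrder n K L := by
  cases n with
  | zero => exact h
  | succ n => exact h.1

theorem mem_allFaces_simplex_inf (G : Finset V) (K : PreAbstractSimplicialComplex V)
    {s : Finset V} : s ∈ allFaces (simplex G ⊓ K) ↔ s ⊆ G ∧ s ∈ allFaces K := by
  constructor
  · rintro (rfl | ⟨⟨-, H, hH, hs⟩, hK⟩)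
    · exact ⟨empty_subset _, Or.inl rfl⟩
    · rw [List.mem_singleton] at hH
      exact ⟨hH ▸ hs, Or.inr hK⟩
  · rintro ⟨hs, rfl | hK⟩
    · exact Or.inl rfl
    · exact Or.inr ⟨⟨(K.isRelLowerSet_faces hK).1, G, List.mem_singleton_self G, hs⟩, hK⟩

theorem mem_allFaces_generated {L : List (Finset V)} (hL : L ≠ []) {s : Finset V} :
    s ∈ allFaces (generated L) ↔ ∃ G ∈ L, s ⊆ G := by
  constructor
  · rintro (rfl | ⟨-, h⟩)
    · obtain ⟨G, hG⟩ := List.exists_mem_of_ne_nil L hL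
      exact ⟨G, hG, empty_subset _⟩
    · exact h
  · intro h
    rcases s.eq_empty_or_nonempty with rfl | hs
    · exact Or.inl rfl
    · exact Or.inr ⟨hs, h⟩

theorem exists_mem_take_iff {L : List (Finset V)} {j : ℕ} (hj : j ≤ L.length) {s : Finset V} :
    (∃ G ∈ L.take j, s ⊆ G) ↔ ∃ l < j, s ⊆ L.getD l ∅ := by
  simp only [List.mem_take_iff_getElem]
  constructor
  · rintro ⟨_, ⟨l, hl, rfl⟩, hs⟩
    exact ⟨l, by omega, by rwa [List.getD_eq_getElem _ _ (by omega)]⟩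
  · rintro ⟨l, hl, hs⟩
    rw [List.getD_eq_getElem _ _ (by omega)] at hs
    exact ⟨_, ⟨l, by omega, rfl⟩, hs⟩

theorem IsFacetOrder.card_getD {n : ℕ} {K : PreAbstractSimplicialComplex V} {L : List (Finset V)}
    (h : IsFacetOrder n K L) {j : ℕ} (hj : j < L.length) : (L.getD j ∅).card = n + 1 := by
  rw [List.getD_eq_getElem _ _ hj]
  exact h.pure _ ((h.mem_iff _).1 (List.getElem_mem hj))

variable [DecidableEq V]

theorem mem_allFaces_generated_take {L : List (Finset V)} {j : ℕ} (h1 : 1 ≤ j) (hj : j ≤ L.length)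
    {s : Finset V} :
    s ∈ allFaces (generated (L.take j)) ↔ s ∈ facesBelow (fun l => L.getD l ∅) j := by
  rw [mem_allFaces_generated, exists_mem_take_iff hj, mem_facesBelow]
  intro h
  have := congrArg List.length h
  rw [List.length_take, List.length_nil] at this
  omega

theorem IsFacetOrder.mem_allFaces_iff {n : ℕ} {K : PreAbstractSimplicialComplex V}
    {L : List (Finset V)} (h : IsFacetOrder n K L) {s : Finset V} :
    s ∈ allFaces K ↔ s ∈ facesBelow (fun l => L.getD l ∅) L.length := by
  have hex : ∀ s ∈ K.faces, ∃ G ∈ L, s ⊆ G := fun s hs => by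
    obtain ⟨G, hsG, hG⟩ := h.finite.exists_le_maximal hs
    exact ⟨G, (h.mem_iff G).2 hG, hsG⟩
  have hne : L ≠ [] := by
    obtain ⟨s, hs⟩ := h.nonempty
    obtain ⟨G, hG, -⟩ := hex s hs
    exact List.ne_nil_of_mem hG
  rw [← mem_allFaces_generated_take (List.length_pos_of_ne_nil hne) le_rfl, List.take_length,
    mem_allFaces_generated hne]
  constructor
  · rintro (rfl | hs)
    · obtain ⟨G, hG⟩ := List.exists_mem_of_ne_nil L hne
      exact ⟨G, hG, empty_subset _⟩
    · exact hex s hs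
  · rintro ⟨G, hG, hs⟩
    rcases s.eq_empty_or_nonempty with rfl | hsn
    · exact Or.inl rfl
    · exact Or.inr ((K.isRelLowerSet_faces ((h.mem_iff G).1 hG).prop).2 hs hsn)

/-- The facets of the boundary of a simplex arise by removing a vertex. -/
theorem exists_erase_eq {n : ℕ} {G H : Finset V} {M : List (Finset V)}
    (hM : IsFacetOrder n (simplexBoundary G) M) (hG : G.card = n + 2) (hH : H ∈ M) :
    ∃ v ∈ G, H = G.erase v := by
  have hmax := (hM.mem_iff H).1 hH
  have hcard := hM.pure H hmax
  have hsub : H ⊂ G := hmax.prop.2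
  obtain ⟨v, hv, hvH⟩ := exists_of_ssubset hsub
  refine ⟨v, hv, eq_of_subset_of_card_le (subset_erase.2 ⟨hsub.subset, hvH⟩) ?_⟩
  rw [card_erase_of_mem hv, hG, hcard]
  omega

/-- The earlier part of the facet is a union of ridges, each omitting one vertex. A face lies in
this union iff it misses one of those vertices, so these vertices form the restriction face. -/
theorem IsShelling.exists_restriction {n : ℕ} {K : PreAbstractSimplicialComplex V}
    {L : List (Finset V)} (h : IsShelling n K L) {j : ℕ} (hj : j < L.length) :
    ∃ R ⊆ L.getD j ∅, ∀ s ⊆ L.getD j ∅, (∃ l < j, s ⊆ L.getD l ∅) ↔ ¬ R ⊆ s := by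
  rcases Nat.eq_zero_or_pos j with rfl | hj0
  · exact ⟨∅, empty_subset _, fun s _ => by simp⟩
  have hfo := h.isFacetOrder
  have hGj : L.getD j ∅ = L[j] := List.getD_eq_getElem _ _ hj
  cases n with
  | zero =>
    -- In dimension `0` a later point shares only the empty face with the earlier points, so the
    -- restriction face is the whole facet.
    refine ⟨L.getD j ∅, Subset.rfl, fun s hs => ⟨?_, fun hns => ?_⟩⟩
    · rintro ⟨l, hl, hsl⟩ hc
      have heq : L.getD j ∅ = L.getD l ∅ := eq_of_subset_of_card_le (hc.trans hsl)
        (by rw [hfo.card_getD hj, hfo.card_getD (hl.trans hj)])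
      rw [hGj, List.getD_eq_getElem _ _ (hl.trans hj), hfo.nodup.getElem_inj_iff] at heq
      omega
    · refine ⟨0, hj0, ?_⟩
      have h1 := card_lt_card (hs.ssubset_of_ne fun he => hns he.ge)
      rw [hfo.card_getD hj] at h1
      rw [card_eq_zero.1 (by omega : s.card = 0)]
      exact empty_subset _
  | succ n =>
    obtain ⟨M, r, hM, hr1, hrM, heq⟩ := h.2.2 j hj hj0
    have hMfo := hM.isFacetOrder
    have hcard := hfo.card_getD hj
    rw [hGj] at hcard ⊢
    have hne : M.take r ≠ [] := by
      intro h0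
      have := congrArg List.length h0
      rw [List.length_take, List.length_nil] at this
      omega
    have hLne : L.take j ≠ [] := by
      intro h0
      have := congrArg List.length h0
      rw [List.length_take, List.length_nil] at this
      omega
    refine ⟨L[j].filter fun v => L[j].erase v ∈ M.take r, filter_subset _ _, fun s hs => ?_⟩
    have h1 : (∃ l < j, s ⊆ L.getD l ∅) ↔ ∃ G ∈ M.take r, s ⊆ G := by
      rw [← exists_mem_take_iff hj.le, ← mem_allFaces_generated hLne, ← mem_allFaces_generated hne,
        ← heq, mem_allFaces_simplex_inf]
      exact (and_iff_right hs).symm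
    rw [h1, not_subset]
    constructor
    · rintro ⟨G, hG, hsG⟩
      obtain ⟨v, hv, rfl⟩ := exists_erase_eq hMfo hcard (List.mem_of_mem_take hG)
      exact ⟨v, mem_filter.2 ⟨hv, hG⟩, fun hvs => absurd (hsG hvs) (by simp)⟩
    · rintro ⟨v, hv, hvs⟩
      exact ⟨_, (mem_filter.1 hv).2, subset_erase.2 ⟨hs, hvs⟩⟩

theorem IsShelling.exists_isSphereShelling {V : Type u} [Fintype V] [LinearOrder V] {n : ℕ}
    {K : PreAbstractSimplicialComplex V} {L : List (Finset V)} (h : IsShelling n K L)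
    (hK : IsGorenstein n K) :
    ∃ R : ℕ → Finset V, IsSphereShelling n L.length (fun l => L.getD l ∅) R := by
  choose! R hR hRc using fun (j : ℕ) (hj : j < L.length) => h.exists_restriction hj
  exact ⟨R, fun j hj => h.isFacetOrder.card_getD hj, hR, hRc,
    fun s hs => hK.euler (fun t => h.isFacetOrder.mem_allFaces_iff) hs⟩

end

end CDIndex

end

/-! ### Assembly of the lemma. -/

open CDIndex
theorem lemma7p23 {V : Type*} [Fintype V] [LinearOrder V] (n : ℕ) (S : PreAbstractSimplicialComplex V)
    (hS : IsGorenstein n S) (F : List (Finset V)) (hF : IsShelling n S F)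
    (i : ℕ) (hi : 1 ≤ i) (hik : i + 2 ≤ F.length)
    -- `σ j = F_1 ∪ ⋯ ∪ F_j`, and `Γ = F_{i+1} ∩ σ i`; the list `F` is indexed from `0`
    (σ : ℕ → PreAbstractSimplicialComplex V) (hσ : ∀ j, σ j = generated (F.take j))
    (Γ : PreAbstractSimplicialComplex V) (hΓ : Γ = simplex F[i] ⊓ σ i) :
    HasLocalCDIndex (P1 (σ i)) ∧ HasLocalCDIndex (P1 (σ (i + 1))) ∧ HasLocalCDIndex (P1 Γ) ∧
    CDLe (localCDIndex (P1 (σ i))) (localCDIndex (P1 (σ (i + 1)))) ∧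
    localCDIndex (P1 (σ (i + 1))) - localCDIndex (P1 (σ i)) =
      localCDIndex (P1 Γ) * varC + cdIndex (BoundaryPoset (P1 Γ)) * varD := by
  obtain ⟨R, h⟩ := hF.exists_isSphereShelling hS
  have hiF : i < F.length := by omega
  have hR0 := h.restriction_nonempty hi hiF
  have hR1 := h.opposite_nonempty (j := i) (by omega)
  have hcard := h.card i hiF
  have hsum := h.card_add_card hiF
  have hpos := hR0.card_pos
  have hpos' := hR1.card_pos
  -- Both `R i` and its complement in the facet are nonempty with sizes adding up to `n + 1`, so `n`
  -- is positive; `Γ` has dimension `m`.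
  obtain ⟨m, rfl⟩ : ∃ m, n = m + 1 := ⟨n - 1, by omega⟩
  obtain ⟨⟨l, hl⟩, β, hβ⟩ := h.exists_cd (i - 1) (by omega)
  obtain ⟨⟨l', hl'⟩, β', hβ'⟩ := h.exists_cd i (by omega)
  rw [Nat.sub_add_cancel hi] at hl hβ
  obtain ⟨x, hx, hx0⟩ := isNonnegCD_locPsi hpos hpos'
  obtain ⟨z, hz, hz0⟩ := isNonnegCD_joinPsi hpos hpos'
  have hfaces : ∀ j, 1 ≤ j → j ≤ F.length →
      ∀ s, s ∈ allFaces (σ j) ↔ s ∈ facesBelow (fun l => F.getD l ∅) j := fun j h1 h2 s => by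
    rw [hσ, mem_allFaces_generated_take h1 h2]
  have hΓfaces : ∀ s, s ∈ allFaces Γ ↔ s ∈ partialBoundary (R i) (F.getD i ∅) := fun s => by
    rw [hΓ, mem_allFaces_simplex_inf, hfaces i hi (by omega), mem_facesBelow, mem_partialBoundary,
      ← List.getD_eq_getElem _ ∅ hiF]
    exact and_congr_right fun hs => h.covered i hiF s hs
  have hrim := facePsi_partialBoundaryRim (h.sub i hiF)
  rw [hcard, show m + 1 + 1 - 2 = m by omega] at hrim
  obtain ⟨a1, a2, -⟩ := (h.isBall hi hiF).hasLocalCDIndex (hfaces i hi (by omega)) hl hβ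
  obtain ⟨b1, b2, -⟩ := (h.isBall (j := i + 1) (by omega) (by omega)).hasLocalCDIndex
    (hfaces (i + 1) (by omega) (by omega)) hl' hβ'
  obtain ⟨c1, c2, c3⟩ := (partialBoundary_isBall (h.sub i hiF) hR0 hR1 hcard).hasLocalCDIndex
    hΓfaces (hx.trans (ballLoc_partialBoundary (h.sub i hiF) hR0 hR1 hcard).symm)
    (hz.trans hrim.symm)
  have hdiff : l' - l = x * varC + z * varD := by
    apply cdToAB_injective
    rw [map_sub, hl', hl, h.ballLoc_succ hi (by omega), add_sub_cancel_left, ← hx, ← hz]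
    simp
  rw [a2, b2, c2, c3]
  refine ⟨a1, b1, c1, ?_, hdiff⟩
  -- The inequality is read off from the explicit difference, since `x` and `z` have nonnegative
  -- coefficients.
  rw [CDLe_iff_nonneg_sub, hdiff]
  exact (hx0.mul (.letter _)).add (hz0.mul (.letter _))
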